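/- Let $\mu=(\mu_i)_{i\ge 0}$ be a probability distribution on $\mathbb{Z}_+$ with mean $1$ and finite variance $\sigma^2>0$. For $\mathcal{A}\subset\mathbb{Z}_+$ write $\mu_{\mathcal{A}}=\sum_{i\in\mathcal{A}}\mu_i$, and, for a finite plane tree $T$, let $N^{\mathcal{A}}(T)$ be the number of vertices of $T$ whose outdegree (number of children) belongs to $\mathcal{A}$; in particular $N^{\mathbb{Z}_+}(T)$ is the total number of vertices of $T$. Let $\mathcal{T}$ be a Galton--Watson tree with offspring distribution $\mu$, i.e. $\mathbb{P}(\mathcal{T}=T)=\prod_{u\in T}\mu_{k_u(T)}$ for every finite plane tree $T$, where $k_u(T)$ is the outdegree of $u$ in $T$. Let $\mathcal{B}\subset\mathbb{Z}_+$ be such that $\mu_{\mathcal{B}}>0$ and $\mu_{\mathcal{B}^c}>0$. For $\mathcal{C}\in\{\mathcal{B},\mathcal{B}^c\}$ let $p_{\mathcal{C}}$ be the probability distribution on $\mathbb{Z}$ given by $p_{\mathcal{C}}(i)=\mu_{i+1}/\mu_{\mathcal{C}}$ if $i+1\in\mathcal{C}$ and $p_{\mathcal{C}}(i)=0$ otherwise.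 Assume that at least one of $p_{\mathcal{B}}$, $p_{\mathcal{B}^c}$ is aperiodic, i.e. its support is not contained in $b+d\mathbb{Z}$ for any $b\in\mathbb{Z}$ and any integer $d\ge 2$. Set $$\gamma_{\mathcal{B}}=\sqrt{\mu_{\mathcal{B}}(1-\mu_{\mathcal{B}})-\frac{1}{\sigma^2}\Big(\sum_{i\in\mathcal{B}}(i-1)\mu_i\Big)^2},$$ and let $\mathcal{T}_k^{\mathcal{B}}$ be distributed as $\mathcal{T}$ conditioned on $N^{\mathcal{B}}(\mathcal{T})=k$ (which makes sense for all $k$ large enough). Then, as $k\to\infty$, $$\mathbb{P}\Big(N^{\mathbb{Z}_+}(\mathcal{T}_k^{\mathcal{B}})=\big\lfloor k/\mu_{\mathcal{B}}+\sqrt{k}\,y\big\rfloor\Big)\sim\sqrt{\frac{\mu_{\mathcal{B}}^3}{2\pi\gamma_{\mathcal{B}}^2}}\;\frac{1}{\sqrt{k}}\,\exp\Big(-\frac{\mu_{\mathcal{B}}^3}{\gamma_{\mathcal{B}}^2}\,\frac{y^2}{2}\Big),$$ uniformly for $y$ in any compact subset of $\mathbb{R}$ (the ratio of the two sides converges to $1$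 uniformly). Moreover, $$\frac{N^{\mathbb{Z}_+}(\mathcal{T}_k^{\mathcal{B}})-k/\mu_{\mathcal{B}}}{\sqrt{k}}\longrightarrow\mathcal{N}\Big(0,\frac{\gamma_{\mathcal{B}}^2}{\mu_{\mathcal{B}}^3}\Big)\quad\text{in distribution as }k\to\infty.$$ -/

import Mathlib

open MeasureTheory ProbabilityTheory Filter Topology

/-- Finite plane (rooted, ordered) trees: a root together with the ordered list of the subtrees
hanging from its children. -/
inductive PlaneTree : Type
  | node (children : List PlaneTree) : PlaneTree

namespace PlaneTree

/-- The outdegrees of all vertices of a plane tree, one entry per vertex, listed in the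
lexicographical (depth-first) order of the vertices. -/
def outdegrees : PlaneTree → List ℕ
  | node children => children.length :: children.attach.flatMap fun t => outdegrees t.1
termination_by T => T
decreasing_by
  have h := List.sizeOf_lt_of_mem t.2
  simp only [PlaneTree.node.sizeOf_spec]
  omega

theorem outdegrees_node (children : List PlaneTree) :
    (node children).outdegrees = children.length :: children.flatMap outdegrees := by
  rw [outdegrees]
  simp [List.flatMap_subtype]

open Classical in
/-- The number of `A`-vertices of `T`, i.e. of vertices whose outdegree belongs to `A`. The total
number of vertices is `T.numVertices Set.univ`. -/
noncomputable def numVertices (A : Set ℕ) (T : PlaneTree) : ℕ :=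
  T.outdegrees.countP fun i => decide (i ∈ A)

instance : MeasurableSpace PlaneTree := ⊤

end PlaneTree

/-- The law of the Galton--Watson tree with offspring distribution `μ`: it gives to each finite
plane tree `T` the mass `∏ μ {outdegree of u}`, the product being over the vertices `u` of `T`. -/
noncomputable def gwLaw (μ : Measure ℕ) : Measure PlaneTree :=
  Measure.sum fun T : PlaneTree => (T.outdegrees.map fun i => μ {i}).prod • Measure.dirac T

/-- The law of the Galton--Watson tree conditioned to have exactly `k` `B`-vertices. -/
noncomputable def gwLawCond (μ : Measure ℕ) (B : Set ℕ) (k : ℕ) : Measure PlaneTree :=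
  cond (gwLaw μ) {T | T.numVertices B = k}

/-- The law of `ξ - 1`, where `ξ` has law `μ` conditioned to belong to `C`; it gives mass
`μ {i + 1} / μ C` to `i` if `i + 1 ∈ C`, and mass `0` otherwise. -/
noncomputable def jumpLaw (μ : Measure ℕ) (C : Set ℕ) : Measure ℤ :=
  (cond μ C).map fun i : ℕ => (i : ℤ) - 1

/-- A measure on `ℤ` is aperiodic (non-lattice) if its support is not contained in any
`b + d ℤ` with `d ≥ 2`. -/
def IsAperiodic (p : Measure ℤ) : Prop :=
  ¬ ∃ b d : ℤ, 2 ≤ d ∧ ∀ i : ℤ, p {i} ≠ 0 → d ∣ i - b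

/-- `γ_B = √(μ_B (1 - μ_B) - (∑_{i ∈ B} (i - 1) μ_i)² / σ²)`, with `σ²` the variance of `μ`. -/
noncomputable def gammaCoef (μ : Measure ℕ) (B : Set ℕ) : ℝ :=
  √(μ.real B * (1 - μ.real B)
    - 1 / Var[fun i : ℕ => (i : ℝ); μ] * (∑' i : B, ((i : ℝ) - 1) * μ.real {(i : ℕ)}) ^ 2)

/-- The law of `(N(T) - k / μ_B) / √k`, where `T` is the Galton--Watson tree conditioned to have
`k` `B`-vertices and `N(T)` is its total number of vertices. -/
noncomputable def rescaledSizeLaw (μ : Measure ℕ) (B : Set ℕ) (k : ℕ) : Measure ℝ :=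
  (gwLawCond μ B k).map fun T =>
    ((T.numVertices Set.univ : ℝ) - k / μ.real B) / √k

instance (μ : Measure ℕ) (B : Set ℕ) (k : ℕ) : IsFiniteMeasure (rescaledSizeLaw μ B k) := by
  unfold rescaledSizeLaw gwLawCond; infer_instance

/-! Write `b` for the mass of `B`, and `p`, `q` for `μ` conditioned on `B` and on `Bᶜ`. The
Otter–Dwass formula turns the tree into sums of independent variables: the probability of `n`
vertices, `k` of them in `B`, is `1 / n` times the probability that a binomial `(n, b)` variable
equals `k`, times the probability that `k` variables of law `p` and `n - k` of law `q` add up to `n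
- 1` (`forestWeight_eq`, `gwLaw_numVertices_eq`).

Put `n ≈ k / b + √k y`. Up to a factor depending on `k` only, the binomial part is a negative
binomial weight, Gaussian in `y` at scale `√k` (`tendsto_sqrt_mul_nbWeight`). The other part obeys a
local limit theorem proved by Fourier inversion (`tendsto_sqrt_mul_coeff_of_or`); one aperiodic law
suffices, since the other characteristic function may be bounded by `1`. Mean one makes both
Gaussians centered at `y = 0`; inverse variances add up in the product, giving `sizeVar`, which
`gammaCoef_sq_div` identifies with the stated variance.

Conditioning divides by the sum over `n`, so pointwise limits must be summed. The tree weights are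
dominated by negative binomial weights whose total mass is explicit and converges to the mass of
their limit (`exists_treeWeight_le`, `hasSum_domWeight`). Dominated convergence with a varying
majorant then treats both the normalization and sums against bounded continuous functions
(`tendsto_tsum_treeWeight`). Uniformity on compact sets is free: the local limits hold along any
countably generated filter, in particular `atTop ×ˢ 𝓝 y`. -/

open scoped ENNReal

/-! ### Weighted forests and the removal of the first root -/

open Classical in
/-- The total weight of the forests of `j` plane trees with `n` vertices, `k` of which are
`B`-vertices, where a vertex of outdegree `i` has weight `w i`. -/
noncomputable def forestWeight (w : ℕ → ℝ≥0∞) (B : Set ℕ) (j n k : ℕ) : ℝ≥0∞ :=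
  ∑' F : List PlaneTree, if F.length = j ∧ (F.flatMap PlaneTree.outdegrees).length = n ∧
    (F.flatMap PlaneTree.outdegrees).countP (fun i => decide (i ∈ B)) = k then
    ((F.flatMap PlaneTree.outdegrees).map w).prod else 0

theorem PlaneTree.outdegrees_length_pos (T : PlaneTree) : 0 < T.outdegrees.length := by
  obtain ⟨cs⟩ := T
  simp [PlaneTree.outdegrees_node]

theorem forestWeight_zero_right (w : ℕ → ℝ≥0∞) (B : Set ℕ) (j k : ℕ) :
    forestWeight w B j 0 k = if j = 0 ∧ k = 0 then 1 else 0 := by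
  unfold forestWeight
  rw [tsum_eq_single []]
  · simp [eq_comm]
  · intro F hF
    obtain ⟨T, F, rfl⟩ := List.exists_cons_of_ne_nil hF
    have := T.outdegrees_length_pos
    rw [if_neg]
    rintro ⟨-, h, -⟩
    simp only [List.flatMap_cons, List.length_append] at h
    omega

theorem forestWeight_zero_left (w : ℕ → ℝ≥0∞) (B : Set ℕ) (n k : ℕ) :
    forestWeight w B 0 (n + 1) k = 0 := by
  unfold forestWeight
  rw [ENNReal.tsum_eq_zero]
  intro F
  rw [if_neg]
  rintro ⟨h, h', -⟩
  rw [List.length_eq_zero_iff] at h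
  subst h
  simp at h'

/-- Grafting: sums over forests of `j + 1` trees, according to the degree of the first root. -/
theorem tsum_forest_cons (H : ℕ → List PlaneTree → ℝ≥0∞) (f : List PlaneTree → ℝ≥0∞) (j : ℕ)
    (h0 : f [] = 0)
    (hf : ∀ cs rest, f (PlaneTree.node cs :: rest) =
      if rest.length = j then H cs.length (cs ++ rest) else 0) :
    ∑' F, f F = ∑' i, ∑' F : List PlaneTree, if F.length = i + j then H i F else 0 := by
  -- Both sums are indexed by pairs (children of the first root, remaining trees). The pair is
  -- recovered from the concatenated forest once the number of children is known.
  have e1 : Function.Injective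
      (fun x : List PlaneTree × List PlaneTree => PlaneTree.node x.1 :: x.2) := by
    rintro ⟨a, b⟩ ⟨c, d⟩ h
    simpa using h
  have e2 : Function.Injective
      (fun x : List PlaneTree × List PlaneTree => (x.1.length, x.1 ++ x.2)) := by
    rintro ⟨a, b⟩ ⟨c, d⟩ h
    simp only [Prod.mk.injEq] at h
    have := List.append_inj h.2 h.1
    simp [this.1, this.2]
  rw [← e1.tsum_eq, ← ENNReal.tsum_prod
    (f := fun i (F : List PlaneTree) => if F.length = i + j then H i F else 0), ← e2.tsum_eq]
  · refine tsum_congr fun x => ?_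
    simp [hf]
  · rintro ⟨i, F⟩ hF
    have hl : F.length = i + j := by
      by_contra hne
      simp [hne] at hF
    exact ⟨(F.take i, F.drop i), by simp [hl]⟩
  · intro F hF
    rcases F with _ | ⟨⟨cs⟩, rest⟩
    · exact absurd h0 hF
    · exact ⟨(cs, rest), rfl⟩

-- Deleting the first root, of outdegree `i`, releases its `i` subtrees next to the `j` other trees.
-- One vertex is lost, and one `B`-vertex when `i ∈ B`; the test `k = 0` guards the truncated
-- subtraction.
open Classical in
theorem forestWeight_succ (w : ℕ → ℝ≥0∞) (B : Set ℕ) (j n k : ℕ) :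
    forestWeight w B (j + 1) (n + 1) k = ∑' i, w i *
      (if i ∈ B then (if k = 0 then 0 else forestWeight w B (i + j) n (k - 1))
        else forestWeight w B (i + j) n k) := by
  unfold forestWeight
  rw [tsum_forest_cons (j := j) (H := fun i F =>
      if (F.flatMap PlaneTree.outdegrees).length = n ∧
        (F.flatMap PlaneTree.outdegrees).countP (fun i => decide (i ∈ B)) +
          (if i ∈ B then 1 else 0) = k then
        w i * ((F.flatMap PlaneTree.outdegrees).map w).prod else 0)]
  · refine tsum_congr fun i => ?_
    by_cases hi : i ∈ B
    · simp only [hi, if_true]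
      rcases k with _ | k
      · simp
      · simp only [Nat.succ_ne_zero, if_false, Nat.add_sub_cancel]
        rw [← ENNReal.tsum_mul_left]
        refine tsum_congr fun F => ?_
        simp only [← ite_and, mul_ite, mul_zero, Nat.add_right_cancel_iff]
    · simp only [hi, if_false]
      rw [← ENNReal.tsum_mul_left]
      refine tsum_congr fun F => ?_
      simp only [← ite_and, mul_ite, mul_zero, Nat.add_zero]
  · simp
  · intro cs rest
    rw [← ite_and]
    congr 1
    · simp only [PlaneTree.outdegrees_node, List.flatMap_cons, List.flatMap_append,
        List.length_append, List.length_cons, List.cons_append, List.countP_cons,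
        List.countP_append, decide_eq_true_eq, Nat.add_right_cancel_iff]
    · simp [PlaneTree.outdegrees_node]

theorem forestWeight_eq_zero_of_lt (w : ℕ → ℝ≥0∞) (B : Set ℕ) {j n : ℕ} (k : ℕ) (h : n < j) :
    forestWeight w B j n k = 0 := by
  induction n generalizing j k with
  | zero => rw [forestWeight_zero_right, if_neg (by omega)]
  | succ n ih =>
    obtain ⟨j, rfl⟩ : ∃ j', j = j' + 1 := ⟨j - 1, by omega⟩
    rw [forestWeight_succ]
    have : ∀ i k, forestWeight w B (i + j) n k = 0 := fun i k => ih k (by omega)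
    simp [this]

/-! ### Bivariate generating function and the Otter–Dwass formula -/

open Polynomial in
open Classical in
/-- The bivariate generating function of the offspring distribution: the second variable
marks the elements of `B`. -/
noncomputable def offspringGF (w : ℕ → ℝ) (B : Set ℕ) : PowerSeries ℝ[X] :=
  PowerSeries.mk fun i => Polynomial.C (w i) * (if i ∈ B then Polynomial.X else 1)

-- The right-hand side has the shape of the summand in `forestWeight_succ`, so that the recursion
-- for forests can be compared with the one for powers of the generating function.
open Classical in
theorem coeff_coeff_offspringGF_mul (w : ℕ → ℝ) (B : Set ℕ) (i k : ℕ) (p : Polynomial ℝ) :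
    (PowerSeries.coeff i (offspringGF w B) * p).coeff k =
      w i * (if i ∈ B then (if k = 0 then 0 else p.coeff (k - 1)) else p.coeff k) := by
  rw [offspringGF, PowerSeries.coeff_mk, mul_assoc, Polynomial.coeff_C_mul]
  congr 1
  split_ifs with h1 h2
  · subst h2; simp
  · obtain ⟨k, rfl⟩ : ∃ k', k = k' + 1 := ⟨k - 1, by omega⟩
    simp [Polynomial.coeff_X_mul]
  · simp

theorem PowerSeries.coeff_pow_succ_eq_sum {R : Type*} [CommRing R] (f : PowerSeries R) (n s : ℕ) :
    coeff s (f ^ (n + 1)) = ∑ i ∈ Finset.range (s + 1), coeff i f * coeff (s - i) (f ^ n) := by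
  rw [pow_succ', coeff_mul, Finset.Nat.sum_antidiagonal_eq_sum_range_succ
    (fun i j => coeff i f * coeff j (f ^ n))]

theorem PowerSeries.coeff_X_mul_derivative {R : Type*} [CommRing R] (f : PowerSeries R) (s : ℕ) :
    coeff s (X * derivative R f) = s * coeff s f := by
  rcases s with _ | s
  · simp
  · rw [coeff_succ_X_mul, coeff_derivative]
    push_cast
    ring

/-- Apply `X d/dX` to `f ^ (n + 1)`. In probabilistic terms, each of `n + 1` exchangeable summands
contributes on average the fraction `1 / (n + 1)` of the total; this replaces the cycle lemma. -/
theorem PowerSeries.natCast_mul_coeff_pow_succ {R : Type*} [CommRing R] (f : PowerSeries R)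
    (n s : ℕ) :
    s * coeff s (f ^ (n + 1)) =
      (n + 1) * ∑ i ∈ Finset.range (s + 1), i * (coeff i f * coeff (s - i) (f ^ n)) := by
  rw [← coeff_X_mul_derivative, Derivation.leibniz_pow]
  have : X * ((n + 1) • f ^ (n + 1 - 1) • derivative R f) =
      ((n + 1 : ℕ) : PowerSeries R) * ((X * derivative R f) * f ^ n) := by
    simp only [Nat.add_sub_cancel, nsmul_eq_mul, smul_eq_mul]
    ring
  rw [this, ← nsmul_eq_mul, map_nsmul, coeff_mul,
    Finset.Nat.sum_antidiagonal_eq_sum_range_succ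
      (fun i j => coeff i (X * derivative R f) * coeff j (f ^ n)), nsmul_eq_mul]
  push_cast
  congr 1
  refine Finset.sum_congr rfl fun i _ => ?_
  rw [coeff_X_mul_derivative]
  ring

theorem coeff_coeff_offspringGF_pow_nonneg {w : ℕ → ℝ} (hw : ∀ i, 0 ≤ w i) (B : Set ℕ)
    (n s k : ℕ) : 0 ≤ (PowerSeries.coeff s (offspringGF w B ^ n)).coeff k := by
  classical
  induction n generalizing s k with
  | zero =>
    rw [pow_zero, PowerSeries.coeff_one]
    split_ifs
    · rw [Polynomial.coeff_one]; split_ifs <;> norm_num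
    · simp
  | succ n ih =>
    rw [PowerSeries.coeff_pow_succ_eq_sum, Polynomial.finsetSum_coeff]
    refine Finset.sum_nonneg fun i _ => ?_
    rw [coeff_coeff_offspringGF_mul]
    refine mul_nonneg (hw i) ?_
    split_ifs
    · exact le_rfl
    · exact ih _ _
    · exact ih _ _

/-- The Otter–Dwass formula, refined by the number of `B`-vertices. -/
theorem forestWeight_eq {w : ℕ → ℝ} (hw : ∀ i, 0 ≤ w i) (B : Set ℕ) (j n k : ℕ) :
    forestWeight (fun i => ENNReal.ofReal (w i)) B j (n + 1) k =
      if j ≤ n + 1 then ENNReal.ofReal ((j : ℝ) / (n + 1) *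
        (PowerSeries.coeff (n + 1 - j) (offspringGF w B ^ (n + 1))).coeff k) else 0 := by
  classical
  split_ifs with hj
  swap
  · exact forestWeight_eq_zero_of_lt _ _ _ (by omega)
  induction n generalizing j k with
  | zero =>
    rcases j with _ | j
    · simp [forestWeight_zero_left]
    obtain rfl : j = 0 := by omega
    rw [forestWeight_succ, tsum_eq_single 0]
    · have := coeff_coeff_offspringGF_mul w B 0 k 1
      rw [mul_one] at this
      simp only [zero_add, pow_one, Nat.sub_self, this, Nat.cast_zero, Nat.cast_one, div_one,
        one_mul]
      rw [ENNReal.ofReal_mul (hw 0)]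
      congr 1
      simp only [forestWeight_zero_right, Polynomial.coeff_one]
      split_ifs <;> simp_all
    · intro i hi
      simp [forestWeight_zero_right, hi]
  | succ n ih =>
    rcases j with _ | j
    · simp [forestWeight_zero_left]
    rw [forestWeight_succ]
    have hn : (0 : ℝ) < (n : ℝ) + 1 := by positivity
    -- The factor `(i + j) / (n + 1)` supplied by the induction hypothesis is affine in `i`: the
    -- constant part sums by `e1`, the linear part by `e2`. With `s + j = n + 1`, the total is `s /
    -- ((n + 1) (n + 2)) + j / (n + 1) = (j + 1) / (n + 2)`.
    have key : ((j + 1 : ℕ) : ℝ) / ((n + 1 : ℕ) + 1) *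
        (PowerSeries.coeff (n + 1 + 1 - (j + 1)) (offspringGF w B ^ (n + 1 + 1))).coeff k =
        ∑ i ∈ Finset.range (n + 1 - j + 1), ((i : ℝ) + j) / (n + 1) *
          (PowerSeries.coeff i (offspringGF w B) *
            PowerSeries.coeff (n + 1 - j - i) (offspringGF w B ^ (n + 1))).coeff k := by
      have hs : n + 1 + 1 - (j + 1) = n + 1 - j := by omega
      rw [hs]
      set s := n + 1 - j with hsdef
      have hsj : (s : ℝ) + j = n + 1 := by
        rw [hsdef]; norm_cast; omega
      have e1 := congrArg (fun p => p.coeff k)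
        (PowerSeries.coeff_pow_succ_eq_sum (offspringGF w B) (n + 1) s)
      have e2 := congrArg (fun p => p.coeff k)
        (PowerSeries.natCast_mul_coeff_pow_succ (offspringGF w B) (n + 1) s)
      simp only [Polynomial.finsetSum_coeff] at e1
      have e2' : (s : ℝ) * (PowerSeries.coeff s (offspringGF w B ^ (n + 1 + 1))).coeff k =
          ((n : ℝ) + 2) * ∑ i ∈ Finset.range (s + 1), (i : ℝ) *
            (PowerSeries.coeff i (offspringGF w B) *
              PowerSeries.coeff (s - i) (offspringGF w B ^ (n + 1))).coeff k := by
        have h2 : (((n + 1 : ℕ) : Polynomial ℝ) + 1) = Polynomial.C ((n : ℝ) + 2) := by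
          rw [Polynomial.C_add, Polynomial.C_eq_natCast, map_ofNat]
          push_cast
          ring
        simp only [h2] at e2
        simp only [← Polynomial.C_eq_natCast, Polynomial.coeff_C_mul,
          Polynomial.finsetSum_coeff] at e2
        exact e2
      have : ∀ i : ℕ, ((i : ℝ) + j) / (n + 1) *
          (PowerSeries.coeff i (offspringGF w B) *
            PowerSeries.coeff (s - i) (offspringGF w B ^ (n + 1))).coeff k =
          (1 / (n + 1)) * ((i : ℝ) * (PowerSeries.coeff i (offspringGF w B) *
            PowerSeries.coeff (s - i) (offspringGF w B ^ (n + 1))).coeff k) +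
          (j / (n + 1)) * ((PowerSeries.coeff i (offspringGF w B) *
            PowerSeries.coeff (s - i) (offspringGF w B ^ (n + 1))).coeff k) := by
        intro i; ring
      simp only [this, Finset.sum_add_distrib, ← Finset.mul_sum]
      rw [← e1]
      have e3 : ∑ i ∈ Finset.range (s + 1), (i : ℝ) *
            (PowerSeries.coeff i (offspringGF w B) *
              PowerSeries.coeff (s - i) (offspringGF w B ^ (n + 1))).coeff k =
          (s : ℝ) / (n + 2) * (PowerSeries.coeff s (offspringGF w B ^ (n + 1 + 1))).coeff k := by
        field_simp
        linarith
      rw [e3]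
      have hs2 : (s : ℝ) = n + 1 - j := by linarith
      rw [hs2]
      push_cast
      field_simp
      ring
    rw [key, ENNReal.ofReal_sum_of_nonneg, tsum_eq_sum (s := Finset.range (n + 1 - j + 1))]
    · refine Finset.sum_congr rfl fun i hi => ?_
      have hij : i + j ≤ n + 1 := by
        have := Finset.mem_range.1 hi; omega
      rw [coeff_coeff_offspringGF_mul, mul_left_comm, ENNReal.ofReal_mul (hw i)]
      congr 1
      have hsub : n + 1 - j - i = n + 1 - (i + j) := by omega
      split_ifs with h1 h2
      · simp
      · rw [ih _ _ hij, hsub]; push_cast; rfl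
      · rw [ih _ _ hij, hsub]; push_cast; rfl
    · intro i hi
      have hij : n + 1 < i + j := by
        have := Finset.mem_range.not.1 hi; omega
      simp [forestWeight_eq_zero_of_lt _ _ _ hij]
    · intro i _
      refine mul_nonneg (by positivity) ?_
      rw [coeff_coeff_offspringGF_mul]
      refine mul_nonneg (hw i) ?_
      split_ifs
      · exact le_rfl
      · exact coeff_coeff_offspringGF_pow_nonneg hw _ _ _ _
      · exact coeff_coeff_offspringGF_pow_nonneg hw _ _ _ _

/-! ### Joint law of the number of vertices and of `B`-vertices -/

open Classical in
theorem offspringGF_eq (w : ℕ → ℝ) (B : Set ℕ) :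
    offspringGF w B =
      PowerSeries.map Polynomial.C (PowerSeries.mk (B.indicator w)) * PowerSeries.C Polynomial.X +
        PowerSeries.map Polynomial.C (PowerSeries.mk (Bᶜ.indicator w)) := by
  ext1 i
  rw [offspringGF, map_add, PowerSeries.coeff_mul_C]
  simp only [PowerSeries.coeff_mk, PowerSeries.coeff_map]
  by_cases hi : i ∈ B <;> simp [hi]

/-- Binomial theorem: the marking variable occurs only in the `B` part, so its exponent counts the
factors taken from that part. -/
theorem coeff_coeff_offspringGF_pow (w : ℕ → ℝ) (B : Set ℕ) (n s k : ℕ) :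
    (PowerSeries.coeff s (offspringGF w B ^ n)).coeff k = n.choose k *
      PowerSeries.coeff s (PowerSeries.mk (B.indicator w) ^ k *
        PowerSeries.mk (Bᶜ.indicator w) ^ (n - k)) := by
  have h : ∀ m, PowerSeries.coeff s ((PowerSeries.map Polynomial.C (PowerSeries.mk (B.indicator w))
      * PowerSeries.C Polynomial.X) ^ m *
        PowerSeries.map Polynomial.C (PowerSeries.mk (Bᶜ.indicator w)) ^ (n - m) *
          ((n.choose m : ℕ) : PowerSeries (Polynomial ℝ))) =
      Polynomial.C (n.choose m * PowerSeries.coeff s (PowerSeries.mk (B.indicator w) ^ m *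
        PowerSeries.mk (Bᶜ.indicator w) ^ (n - m))) * Polynomial.X ^ m := by
    intro m
    have : (PowerSeries.map Polynomial.C (PowerSeries.mk (B.indicator w))
      * PowerSeries.C Polynomial.X) ^ m *
        PowerSeries.map Polynomial.C (PowerSeries.mk (Bᶜ.indicator w)) ^ (n - m) *
          ((n.choose m : ℕ) : PowerSeries (Polynomial ℝ)) =
        n.choose m • (PowerSeries.map Polynomial.C (PowerSeries.mk (B.indicator w) ^ m *
          PowerSeries.mk (Bᶜ.indicator w) ^ (n - m)) * PowerSeries.C (Polynomial.X ^ m)) := by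
      rw [nsmul_eq_mul, map_mul, map_pow, map_pow, map_pow]
      ring
    rw [this, map_nsmul, PowerSeries.coeff_mul_C, PowerSeries.coeff_map, nsmul_eq_mul,
      Polynomial.C_mul, Polynomial.C_eq_natCast, mul_assoc]
  rw [offspringGF_eq, add_pow, map_sum, Polynomial.finsetSum_coeff]
  simp only [h, Polynomial.coeff_C_mul, Polynomial.coeff_X_pow]
  simp only [mul_ite, mul_one, mul_zero, Finset.sum_ite_eq, Finset.mem_range]
  split_ifs with hk
  · rfl
  · rw [Nat.choose_eq_zero_of_lt (by omega)]
    simp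

/-- The generating function of a measure on `ℕ`. -/
noncomputable def genFun (p : Measure ℕ) : PowerSeries ℝ := PowerSeries.mk fun i => p.real {i}

theorem mk_indicator_eq_genFun_cond (μ : Measure ℕ) [IsFiniteMeasure μ] {B : Set ℕ} (hB : μ B ≠ 0) :
    PowerSeries.mk (B.indicator fun i => μ.real {i}) =
      PowerSeries.C (μ.real B) * genFun (cond μ B) := by
  ext i
  rw [PowerSeries.coeff_C_mul, genFun, PowerSeries.coeff_mk, PowerSeries.coeff_mk,
    measureReal_def (cond μ B), cond_apply (MeasurableSet.of_discrete), ENNReal.toReal_mul,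
    ENNReal.toReal_inv, ← measureReal_def, ← measureReal_def]
  have : μ.real B ≠ 0 := by
    simp [Measure.real, ENNReal.toReal_eq_zero_iff, hB]
  rw [mul_inv_cancel_left₀ this]
  by_cases hi : i ∈ B
  · rw [Set.indicator_of_mem hi, Set.inter_eq_right.2 (by simpa using hi)]
  · rw [Set.indicator_of_notMem hi, Set.inter_singleton_eq_empty.2 hi]
    simp

open Classical in
theorem gwLaw_apply (μ : Measure ℕ) (S : Set PlaneTree) :
    gwLaw μ S = ∑' T : PlaneTree, if T ∈ S then (T.outdegrees.map fun i => μ {i}).prod else 0 := by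
  rw [gwLaw, Measure.sum_apply _ (by trivial)]
  refine tsum_congr fun T => ?_
  rw [Measure.smul_apply, Measure.dirac_apply' _ (by trivial)]
  by_cases h : T ∈ S <;> simp [h]

theorem gwLaw_eq_forestWeight (μ : Measure ℕ) (B : Set ℕ) (n k : ℕ) :
    gwLaw μ {T | T.numVertices Set.univ = n ∧ T.numVertices B = k} =
      forestWeight (fun i => μ {i}) B 1 n k := by
  classical
  have e : Function.Injective (fun T : PlaneTree => [T]) := fun a b h => by simpa using h
  rw [gwLaw_apply, forestWeight, ← e.tsum_eq]
  · refine tsum_congr fun T => ?_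
    simp [PlaneTree.numVertices]
  · intro F hF
    obtain ⟨T, rfl⟩ : ∃ T, F = [T] := by
      refine List.length_eq_one_iff.1 ?_
      by_contra hne
      simp [hne] at hF
    exact ⟨T, rfl⟩

/-- The exact formula on which all asymptotics rest. The coefficient has index `n` because a tree
with `n + 1` vertices has `n` non-root vertices, which is the sum of its outdegrees. -/
theorem gwLaw_numVertices_eq (μ : Measure ℕ) [IsProbabilityMeasure μ] {B : Set ℕ} (hB : μ B ≠ 0)
    (hBc : μ Bᶜ ≠ 0) (n k : ℕ) :
    gwLaw μ {T | T.numVertices Set.univ = n + 1 ∧ T.numVertices B = k} =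
      ENNReal.ofReal (1 / (n + 1) * ((n + 1).choose k * μ.real B ^ k * (1 - μ.real B) ^ (n + 1 - k))
        * PowerSeries.coeff n (genFun (cond μ B) ^ k * genFun (cond μ Bᶜ) ^ (n + 1 - k))) := by
  rw [gwLaw_eq_forestWeight]
  have h : (fun i => μ {i}) = fun i => ENNReal.ofReal (μ.real {i}) := by
    ext i
    rw [ofReal_measureReal]
  rw [h, forestWeight_eq (fun i => measureReal_nonneg), if_pos (by omega),
    coeff_coeff_offspringGF_pow, mk_indicator_eq_genFun_cond μ hB,
    mk_indicator_eq_genFun_cond μ hBc, probReal_compl_eq_one_sub (MeasurableSet.of_discrete)]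
  rw [mul_pow, mul_pow, mul_mul_mul_comm, ← map_pow, ← map_pow, ← map_mul,
    PowerSeries.coeff_C_mul]
  congr 1
  simp only [Nat.add_sub_cancel, Nat.cast_one]
  ring

theorem gwLaw_numVertices_zero (μ : Measure ℕ) (B : Set ℕ) (k : ℕ) :
    gwLaw μ {T | T.numVertices Set.univ = 0 ∧ T.numVertices B = k} = 0 := by
  rw [gwLaw_eq_forestWeight, forestWeight_zero_right, if_neg (by simp)]

/-! ### Fourier inversion for coefficients of generating functions -/

/-- The value at `exp (i t)` of a real power series. -/
noncomputable def PowerSeries.circleEval (f : PowerSeries ℝ) (t : ℝ) : ℂ :=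
  ∑' i, ((coeff i f : ℝ) : ℂ) * Complex.exp (t * i * Complex.I)

namespace PowerSeries

theorem norm_circleEval_term (f : PowerSeries ℝ) (t : ℝ) (i : ℕ) :
    ‖((coeff i f : ℝ) : ℂ) * Complex.exp (t * i * Complex.I)‖ = ‖coeff i f‖ := by
  have := Complex.norm_exp_ofReal_mul_I (t * i)
  push_cast at this
  rw [norm_mul, this, mul_one, Complex.norm_real]

theorem sum_antidiagonal_circleEval (f g : PowerSeries ℝ) (t : ℝ) (n : ℕ) :
    ∑ kl ∈ Finset.HasAntidiagonal.antidiagonal n,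
      (((coeff kl.1 f : ℝ) : ℂ) * Complex.exp (t * kl.1 * Complex.I)) *
      (((coeff kl.2 g : ℝ) : ℂ) * Complex.exp (t * kl.2 * Complex.I)) =
      ((coeff n (f * g) : ℝ) : ℂ) * Complex.exp (t * n * Complex.I) := by
  rw [coeff_mul, Complex.ofReal_sum, Finset.sum_mul]
  refine Finset.sum_congr rfl fun kl hkl => ?_
  rw [← Finset.HasAntidiagonal.mem_antidiagonal.1 hkl, mul_mul_mul_comm, ← Complex.exp_add]
  push_cast
  ring_nf

theorem summable_norm_mul {f g : PowerSeries ℝ} (hf : Summable fun i => ‖coeff i f‖)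
    (hg : Summable fun i => ‖coeff i g‖) : Summable fun i => ‖coeff i (f * g)‖ := by
  have h := summable_norm_sum_mul_antidiagonal_of_summable_norm
    (f := fun i => coeff i f) (g := fun i => coeff i g) hf hg
  simpa only [coeff_mul] using h

theorem circleEval_mul {f g : PowerSeries ℝ} (hf : Summable fun i => ‖coeff i f‖)
    (hg : Summable fun i => ‖coeff i g‖) (t : ℝ) :
    (f * g).circleEval t = f.circleEval t * g.circleEval t := by
  unfold circleEval
  rw [tsum_mul_tsum_eq_tsum_sum_antidiagonal_of_summable_norm]
  · exact tsum_congr fun n => (sum_antidiagonal_circleEval f g t n).symm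
  · simpa only [norm_circleEval_term] using hf
  · simpa only [norm_circleEval_term] using hg

theorem summable_norm_one : Summable fun i => ‖coeff i (1 : PowerSeries ℝ)‖ := by
  refine summable_of_ne_finset_zero (s := {0}) fun i hi => ?_
  rw [coeff_one, if_neg (by simpa using hi), norm_zero]

theorem circleEval_one (t : ℝ) : (1 : PowerSeries ℝ).circleEval t = 1 := by
  unfold circleEval
  rw [tsum_eq_single 0]
  · simp
  · intro i hi
    simp [coeff_one, hi]

theorem summable_norm_pow {f : PowerSeries ℝ} (hf : Summable fun i => ‖coeff i f‖) (k : ℕ) :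
    Summable fun i => ‖coeff i (f ^ k)‖ := by
  induction k with
  | zero => simpa using summable_norm_one
  | succ k ih => rw [pow_succ]; exact summable_norm_mul ih hf

theorem circleEval_pow {f : PowerSeries ℝ} (hf : Summable fun i => ‖coeff i f‖) (k : ℕ) (t : ℝ) :
    (f ^ k).circleEval t = f.circleEval t ^ k := by
  induction k with
  | zero => simpa using circleEval_one t
  | succ k ih => rw [pow_succ, circleEval_mul (summable_norm_pow hf k) hf, ih, pow_succ]

theorem integral_exp_int_mul (n : ℤ) :
    ∫ t in -Real.pi..Real.pi, Complex.exp (t * n * Complex.I) =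
      if n = 0 then (2 * Real.pi : ℂ) else 0 := by
  split_ifs with h
  · subst h
    simp
    ring
  · have h' : (n : ℂ) * Complex.I ≠ 0 := by simp [h]
    have : ∀ t : ℝ, Complex.exp (t * n * Complex.I) = Complex.exp ((n * Complex.I) * t) := by
      intro t; ring_nf
    simp only [this]
    rw [integral_exp_mul_complex h', div_eq_zero_iff]
    left
    rw [sub_eq_zero, Complex.exp_eq_exp_iff_exists_int]
    refine ⟨n, ?_⟩
    push_cast
    ring

/-- Fourier inversion for absolutely summable power series. -/
theorem coeff_eq_integral {f : PowerSeries ℝ} (hf : Summable fun i => ‖coeff i f‖) (s : ℕ) :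
    ((coeff s f : ℝ) : ℂ) = (2 * Real.pi : ℂ)⁻¹ * ∫ t in -Real.pi..Real.pi,
      f.circleEval t * Complex.exp (-(t * s * Complex.I)) := by
  have h := intervalIntegral.hasSum_integral_of_dominated_convergence (μ := volume)
    (a := -Real.pi) (b := Real.pi)
    (F := fun (i : ℕ) (t : ℝ) => ((coeff i f : ℝ) : ℂ) * Complex.exp (t * i * Complex.I) *
      Complex.exp (-(t * s * Complex.I)))
    (f := fun t => f.circleEval t * Complex.exp (-(t * s * Complex.I)))
    (fun i _ => ‖coeff i f‖) (fun i => ?_) ?_ ?_ ?_ ?_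
  · have e : ∀ i : ℕ, ∫ t in -Real.pi..Real.pi, ((coeff i f : ℝ) : ℂ) * Complex.exp (t * i * Complex.I) *
        Complex.exp (-(t * s * Complex.I)) =
        if i = s then (2 * Real.pi : ℂ) * (coeff s f : ℝ) else 0 := by
      intro i
      have : ∀ t : ℝ, ((coeff i f : ℝ) : ℂ) * Complex.exp (t * i * Complex.I) *
        Complex.exp (-(t * s * Complex.I)) =
          ((coeff i f : ℝ) : ℂ) * Complex.exp (t * ((i - s : ℤ) : ℂ) * Complex.I) := by
        intro t
        rw [mul_assoc, ← Complex.exp_add]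
        push_cast
        ring_nf
      simp only [this, intervalIntegral.integral_const_mul, integral_exp_int_mul]
      by_cases his : i = s
      · subst his; simp; ring
      · have : (i - s : ℤ) ≠ 0 := by omega
        simp [his, this]
    simp only [e] at h
    rw [h.unique (hasSum_ite_eq s _)]
    have : (Real.pi : ℂ) ≠ 0 := by exact_mod_cast Real.pi_ne_zero
    field_simp
  · exact Continuous.aestronglyMeasurable (by fun_prop)
  · refine fun i => ae_of_all _ fun t _ => le_of_eq ?_
    rw [norm_mul, norm_circleEval_term]
    have := Complex.norm_exp_ofReal_mul_I (-(t * s))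
    push_cast at this
    rw [← neg_mul, this, mul_one]
  · exact ae_of_all _ fun t _ => hf
  · exact intervalIntegrable_const
  · refine ae_of_all _ fun t _ => HasSum.mul_right _ ?_
    refine (Summable.of_norm ?_).hasSum
    simpa only [norm_circleEval_term] using hf

end PowerSeries

section

variable (p : Measure ℕ) [IsProbabilityMeasure p]

instance : IsProbabilityMeasure (p.map (Nat.cast : ℕ → ℝ)) :=
  Measure.isProbabilityMeasure_map (by fun_prop)

theorem hasSum_measureReal_singleton : HasSum (fun i => p.real {i}) 1 := by
  have h : Summable fun i => p.real {i} := by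
    refine ENNReal.summable_toReal ?_
    have := p.tsum_indicator_apply_singleton Set.univ MeasurableSet.univ
    simp only [Set.indicator_univ] at this
    simp [this]
  have := integral_countable (μ := p) (f := fun _ => (1 : ℝ)) (integrable_const _)
  simp only [integral_const, probReal_univ, smul_eq_mul, mul_one] at this
  rw [this]
  exact h.hasSum

theorem summable_norm_genFun : Summable fun i => ‖PowerSeries.coeff i (genFun p)‖ := by
  simp only [genFun, PowerSeries.coeff_mk, Real.norm_eq_abs, abs_of_nonneg measureReal_nonneg]
  exact (hasSum_measureReal_singleton p).summable

theorem circleEval_genFun (t : ℝ) :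
    (genFun p).circleEval t = charFun (p.map (Nat.cast : ℕ → ℝ)) t := by
  rw [charFun_apply_real, integral_map (by fun_prop)
    (Continuous.aestronglyMeasurable (by fun_prop)), integral_countable]
  · simp [PowerSeries.circleEval, genFun]
  · refine Integrable.of_bound (by fun_prop) 1 (ae_of_all _ fun i => ?_)
    have := Complex.norm_exp_ofReal_mul_I (t * i)
    push_cast at this ⊢
    rw [this]

variable (q : Measure ℕ) [IsProbabilityMeasure q]

/-- The coefficient is the mass at `s` of a sum of `k` variables of law `p` and `m` of law `q`, all
independent; being integer-valued, the sum needs only one period of its characteristic function. -/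
theorem coeff_genFun_pow_mul_pow (k m s : ℕ) :
    ((PowerSeries.coeff s (genFun p ^ k * genFun q ^ m) : ℝ) : ℂ) = (2 * Real.pi : ℂ)⁻¹ *
      ∫ t in -Real.pi..Real.pi, charFun (p.map (Nat.cast : ℕ → ℝ)) t ^ k *
        charFun (q.map (Nat.cast : ℕ → ℝ)) t ^ m * Complex.exp (-(t * s * Complex.I)) := by
  have hp := PowerSeries.summable_norm_pow (summable_norm_genFun p) k
  have hq := PowerSeries.summable_norm_pow (summable_norm_genFun q) m
  rw [PowerSeries.coeff_eq_integral (PowerSeries.summable_norm_mul hp hq)]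
  simp only [PowerSeries.circleEval_mul hp hq, PowerSeries.circleEval_pow (summable_norm_genFun _),
    circleEval_genFun]

end

/-! ### Characteristic functions of laws on `ℕ`: expansion at `0` and Gaussian bounds -/

open Asymptotics in
theorem isLittleO_exp_neg_mul_sq (v : ℝ) :
    (fun t : ℝ => Complex.exp (-(v * t ^ 2 / 2)) - (1 - v * t ^ 2 / 2)) =o[𝓝 0]
      fun t : ℝ => t ^ 2 := by
  have h1 : Tendsto (fun t : ℝ => -(v * t ^ 2 / 2 : ℂ)) (𝓝 0) (𝓝 0) := by
    have : Continuous (fun t : ℝ => -(v * t ^ 2 / 2 : ℂ)) := by fun_prop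
    simpa using this.tendsto 0
  have h2 := (Complex.exp_sub_sum_range_succ_isLittleO_pow 1).comp_tendsto h1
  have h3 : (fun t : ℝ => -(v * t ^ 2 / 2 : ℂ)) =O[𝓝 0] fun t : ℝ => t ^ 2 := by
    refine IsBigO.of_bound |v / 2| (Eventually.of_forall fun t => le_of_eq ?_)
    rw [norm_neg]
    have : (v * t ^ 2 / 2 : ℂ) = ((v / 2 * t ^ 2 : ℝ) : ℂ) := by push_cast; ring
    rw [this, Complex.norm_real, norm_mul, Real.norm_eq_abs]
  refine IsLittleO.congr' (h2.trans_isBigO ?_) ?_ EventuallyEq.rfl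
  · simpa [Function.comp_def] using h3
  · refine Eventually.of_forall fun t => ?_
    simp [Finset.sum_range_succ]
    ring

theorem charFun_natCast_eq {p : Measure ℕ} (t : ℝ) :
    charFun (p.map (Nat.cast : ℕ → ℝ)) t = ∫ i : ℕ, Complex.exp (t * i * Complex.I) ∂p := by
  rw [charFun_apply_real, integral_map (by fun_prop)
    (Continuous.aestronglyMeasurable (by fun_prop))]
  simp

section

variable {p : Measure ℕ} [IsProbabilityMeasure p]

theorem continuous_charFun_natCast : Continuous (charFun (p.map (Nat.cast : ℕ → ℝ))) :=
  continuous_charFun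

/-- Second-order expansion at `0` of the characteristic function of the centered variable. -/
theorem isLittleO_charFun_centered (hp : MemLp (fun i : ℕ => (i : ℝ)) 2 p) :
    (fun t : ℝ => charFun (p.map (Nat.cast : ℕ → ℝ)) t *
        Complex.exp (-(t * (∫ i : ℕ, (i : ℝ) ∂p : ℝ) * Complex.I)) -
        Complex.exp (-(Var[fun i : ℕ => (i : ℝ); p] * t ^ 2 / 2))) =o[𝓝 0] fun t : ℝ => t ^ 2 := by
  set m : ℝ := ∫ i : ℕ, (i : ℝ) ∂p with hm
  set v : ℝ := Var[fun i : ℕ => (i : ℝ); p] with hv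
  have hX : AEMeasurable (fun i : ℕ => (i : ℝ) - m) p := by fun_prop
  have hX2 : MemLp (fun i : ℕ => (i : ℝ) - m) 2 p := hp.sub (memLp_const m)
  have hid : MemLp id 2 (p.map fun i : ℕ => (i : ℝ) - m) := by
    rw [memLp_map_measure_iff (by fun_prop) hX]
    exact hX2
  have hprob : IsProbabilityMeasure (p.map fun i : ℕ => (i : ℝ) - m) :=
    Measure.isProbabilityMeasure_map hX
  have h0 : p[fun i : ℕ => (i : ℝ) - m] = 0 := by
    rw [integral_sub (hp.integrable (by norm_num)) (integrable_const _)]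
    simp [hm]
  have h1 : p[(fun i : ℕ => (i : ℝ) - m) ^ 2] = v := by
    rw [hv, variance_eq_integral (by fun_prop)]
    rfl
  have h := taylor_isLittleO_univ (x₀ := 0) (contDiff_charFun hid)
  have ht : ∀ t, taylorWithinEval (charFun (p.map fun i : ℕ => (i : ℝ) - m)) 2 Set.univ 0 t =
      1 - v * t ^ 2 / 2 := by
    intro t
    rw [taylorWithinEval_charFun_two_zero hX hid, h0, h1]
    simp
  have hc : ∀ t, charFun (p.map fun i : ℕ => (i : ℝ) - m) t =
      charFun (p.map (Nat.cast : ℕ → ℝ)) t * Complex.exp (-(t * m * Complex.I)) := by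
    intro t
    rw [charFun_natCast_eq, charFun_apply_real, integral_map hX
      (Continuous.aestronglyMeasurable (by fun_prop)), ← integral_mul_const]
    refine integral_congr_ae (ae_of_all _ fun i => ?_)
    simp only
    rw [← Complex.exp_add]
    push_cast
    ring_nf
  simp only [ht, hc, sub_zero] at h
  refine (h.sub (isLittleO_exp_neg_mul_sq v)).congr (fun t => ?_) fun _ => rfl
  ring

/-- Centering multiplies the characteristic function by a phase, so its modulus can be read off the
centered second-order expansion. -/
theorem norm_charFun_natCast_le_of_variance (hp : MemLp (fun i : ℕ => (i : ℝ)) 2 p)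
    (hv : 0 < Var[fun i : ℕ => (i : ℝ); p]) :
    ∃ c > 0, ∃ δ > 0, ∀ t : ℝ, |t| < δ →
      ‖charFun (p.map (Nat.cast : ℕ → ℝ)) t‖ ≤ Real.exp (-(c * t ^ 2)) := by
  set m : ℝ := ∫ i : ℕ, (i : ℝ) ∂p with hm
  set v : ℝ := Var[fun i : ℕ => (i : ℝ); p] with hv
  -- An error of `v t² / 8` leaves room: `1 - v t² / 2 + v t² / 8 ≤ 1 - v t² / 4 ≤ exp (-v t² / 4)`.
  have h1 := ((isLittleO_charFun_centered hp).add (isLittleO_exp_neg_mul_sq v)).def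
    (show 0 < v / 8 by positivity)
  have h2 : ∀ᶠ t : ℝ in 𝓝 0, v * t ^ 2 / 2 < 1 := by
    have : Continuous (fun t : ℝ => v * t ^ 2 / 2) := by fun_prop
    exact this.tendsto 0 |>.eventually (gt_mem_nhds (by simp))
  obtain ⟨δ, hδ, h⟩ := Metric.eventually_nhds_iff.1 (h1.and h2)
  refine ⟨v / 4, by positivity, δ, hδ, fun t ht => ?_⟩
  obtain ⟨h3, h4⟩ := h (by simpa using ht)
  rw [← hm] at h3
  have h5 : ‖charFun (p.map (Nat.cast : ℕ → ℝ)) t‖ =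
      ‖charFun (p.map (Nat.cast : ℕ → ℝ)) t * Complex.exp (-(t * m * Complex.I))‖ := by
    have := Complex.norm_exp_ofReal_mul_I (-(t * m))
    push_cast at this
    rw [norm_mul, ← neg_mul, this, mul_one]
  rw [h5]
  set z := charFun (p.map (Nat.cast : ℕ → ℝ)) t * Complex.exp (-(t * m * Complex.I))
  have h6 : ‖z - (1 - v * t ^ 2 / 2 : ℝ)‖ ≤ v / 8 * t ^ 2 := by
    rw [Real.norm_of_nonneg (sq_nonneg t)] at h3
    refine le_trans (le_of_eq ?_) h3
    congr 1
    push_cast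
    ring
  have h7 : ‖((1 - v * t ^ 2 / 2 : ℝ) : ℂ)‖ = 1 - v * t ^ 2 / 2 := by
    rw [Complex.norm_real, Real.norm_of_nonneg (by linarith)]
  have h8 := norm_le_norm_add_norm_sub' z ((1 - v * t ^ 2 / 2 : ℝ) : ℂ)
  rw [h7] at h8
  have h9 := Real.add_one_le_exp (-(v / 4 * t ^ 2))
  nlinarith [mul_nonneg (show 0 ≤ v by positivity) (sq_nonneg t)]

/-- If the characteristic function has modulus `1` at `t`, then `exp (i t j)` is constant on
the support. -/
theorem exp_eq_of_norm_charFun_eq_one {t : ℝ}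
    (h : ‖charFun (p.map (Nat.cast : ℕ → ℝ)) t‖ = 1) {j : ℕ} (hj : p {j} ≠ 0) :
    Complex.exp (t * j * Complex.I) = charFun (p.map (Nat.cast : ℕ → ℝ)) t := by
  set z := charFun (p.map (Nat.cast : ℕ → ℝ)) t with hz
  have hint : Integrable (fun i : ℕ => Complex.exp (t * i * Complex.I)) p := by
    refine Integrable.of_bound (by fun_prop) 1 (ae_of_all _ fun i => ?_)
    have := Complex.norm_exp_ofReal_mul_I (t * i)
    push_cast at this
    rw [this]
  have hn : ∀ i : ℕ, ‖Complex.exp (t * i * Complex.I)‖ = 1 := by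
    intro i
    have := Complex.norm_exp_ofReal_mul_I (t * i)
    push_cast at this
    exact this
  have hnorm : z * (starRingEnd ℂ) z = 1 := by
    rw [Complex.mul_conj, Complex.normSq_eq_norm_sq, h]; simp
  have hnorm' : ‖(starRingEnd ℂ) z‖ = 1 := by rw [Complex.norm_conj, h]
  have hreint : Integrable (fun i : ℕ =>
      (Complex.exp (t * i * Complex.I) * (starRingEnd ℂ) z).re) p := (hint.mul_const _).re
  -- Equality case of the triangle inequality: a nonnegative function with zero integral vanishes at
  -- every atom, and a complex number of modulus one and real part one is `1`.
  have h1 : ∫ i : ℕ, (1 - (Complex.exp (t * i * Complex.I) * (starRingEnd ℂ) z).re) ∂p = 0 := by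
    rw [integral_sub (integrable_const _) hreint]
    have : ∫ i : ℕ, (Complex.exp (t * i * Complex.I) * (starRingEnd ℂ) z).re ∂p =
        (∫ i : ℕ, Complex.exp (t * i * Complex.I) * (starRingEnd ℂ) z ∂p).re :=
      integral_re (hint.mul_const _)
    rw [this, integral_mul_const, ← charFun_natCast_eq, ← hz, hnorm]
    simp
  have hle : ∀ i : ℕ, (Complex.exp (t * i * Complex.I) * (starRingEnd ℂ) z).re ≤ 1 := by
    intro i
    refine (Complex.re_le_norm _).trans ?_
    rw [norm_mul, hn, hnorm', one_mul]
  rw [integral_eq_zero_iff_of_nonneg (fun i => sub_nonneg.2 (hle i))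
    ((integrable_const _).sub hreint)] at h1
  have h2 : 1 - (Complex.exp (t * j * Complex.I) * (starRingEnd ℂ) z).re = 0 := by
    by_contra hne
    refine hj (measure_mono_null ?_ (ae_iff.1 h1))
    rintro i rfl
    exact hne
  have h3 : Complex.exp (t * j * Complex.I) * (starRingEnd ℂ) z = 1 := by
    have hnn : ‖Complex.exp (t * j * Complex.I) * (starRingEnd ℂ) z‖ = 1 := by
      rw [norm_mul, hn, hnorm', one_mul]
    have hre : (Complex.exp (t * j * Complex.I) * (starRingEnd ℂ) z).re = 1 := by linarith
    have := Complex.sq_norm_sub_sq_re (Complex.exp (t * j * Complex.I) * (starRingEnd ℂ) z)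
    rw [hnn, hre] at this
    apply Complex.ext
    · simpa using hre
    · have h' : (Complex.exp (t * j * Complex.I) * (starRingEnd ℂ) z).im ^ 2 = 0 := by
        rw [← this]; norm_num
      simpa using h'
  calc Complex.exp (t * j * Complex.I)
      = Complex.exp (t * j * Complex.I) * (z * (starRingEnd ℂ) z) := by rw [hnorm, mul_one]
    _ = z * (Complex.exp (t * j * Complex.I) * (starRingEnd ℂ) z) := by ring
    _ = z := by rw [h3, mul_one]

/-- A measure on `ℕ` is aperiodic if its support is not contained in any `b + d ℤ`, `d ≥ 2`. -/
def IsAperiodicNat (p : Measure ℕ) : Prop :=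
  ∀ b d : ℤ, 2 ≤ d → ∃ i : ℕ, p {i} ≠ 0 ∧ ¬ d ∣ i - b

/-- If the modulus were `1`, the integers `z` with `exp (i t z) = 1` would form a subgroup
containing all differences of support points. Aperiodicity makes it all of `ℤ`, hence `t ∈ 2πℤ`,
which is excluded for `0 < |t| ≤ π`. -/
theorem norm_charFun_natCast_lt_one (hap : IsAperiodicNat p) {t : ℝ} (ht0 : t ≠ 0)
    (ht : |t| ≤ Real.pi) : ‖charFun (p.map (Nat.cast : ℕ → ℝ)) t‖ < 1 := by
  refine lt_of_le_of_ne (norm_charFun_le_one t) fun h => ?_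
  have hexp := fun {j : ℕ} (hj : p {j} ≠ 0) => exp_eq_of_norm_charFun_eq_one h hj
  -- Only the existence of a support point matters here; the values `0` and `2` are arbitrary.
  obtain ⟨a, ha, -⟩ := hap 0 2 le_rfl
  let H : AddSubgroup ℤ :=
    { carrier := {z | Complex.exp (t * z * Complex.I) = 1}
      zero_mem' := by simp
      add_mem' := by
        intro x y hx hy
        simp only [Set.mem_ofPred_eq] at hx hy ⊢
        push_cast
        rw [mul_add, add_mul, Complex.exp_add, hx, hy, one_mul]
      neg_mem' := by
        intro x hx
        simp only [Set.mem_ofPred_eq] at hx ⊢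
        push_cast
        rw [mul_neg, neg_mul, Complex.exp_neg, hx, inv_one] }
  have hH : ∀ z : ℤ, z ∈ H ↔ Complex.exp (t * z * Complex.I) = 1 := fun z => Iff.rfl
  have hmem : ∀ j : ℕ, p {j} ≠ 0 → (j : ℤ) - a ∈ H := by
    intro j hj
    rw [hH]
    push_cast
    rw [mul_sub, sub_mul, Complex.exp_sub, hexp hj, hexp ha, div_self]
    rw [← hexp ha]
    exact Complex.exp_ne_zero _
  obtain ⟨g, hg⟩ := Int.subgroup_cyclic H
  have hdvd : ∀ j : ℕ, p {j} ≠ 0 → g ∣ (j : ℤ) - a := by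
    intro j hj
    have := hmem j hj
    rw [hg, ← AddSubgroup.zmultiples_eq_closure] at this
    exact Int.mem_zmultiples_iff.1 this
  have hone : |g| = 1 := by
    by_contra hne
    rcases eq_or_ne g 0 with rfl | h0
    · obtain ⟨i, hi, hi'⟩ := hap a 2 le_rfl
      have := hdvd i hi
      rw [zero_dvd_iff] at this
      exact hi' (this ▸ dvd_zero _)
    · have : 2 ≤ |g| := by
        have := abs_pos.2 h0
        omega
      obtain ⟨i, hi, hi'⟩ := hap a |g| this
      exact hi' ((abs_dvd _ _).2 (hdvd i hi))
  have h1 : (1 : ℤ) ∈ H := by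
    rw [hg, ← AddSubgroup.zmultiples_eq_closure, Int.mem_zmultiples_iff]
    exact (abs_dvd _ _).1 (hone ▸ dvd_rfl)
  rw [hH, Complex.exp_eq_one_iff] at h1
  obtain ⟨n, hn⟩ := h1
  have hn' : t = n * (2 * Real.pi) := by
    have : (t : ℂ) = n * (2 * Real.pi) := by
      have h2 : (t : ℂ) * Complex.I = (n * (2 * Real.pi)) * Complex.I := by
        push_cast at hn
        linear_combination hn
      exact mul_right_cancel₀ Complex.I_ne_zero h2
    exact_mod_cast this
  have hn0 : n ≠ 0 := by
    rintro rfl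
    simp at hn'
    exact ht0 hn'
  have : (1 : ℝ) ≤ |(n : ℝ)| := by exact_mod_cast Int.one_le_abs hn0
  rw [hn', abs_mul, abs_of_pos (by positivity : (0 : ℝ) < 2 * Real.pi)] at ht
  nlinarith [Real.pi_pos]

theorem IsAperiodicNat.variance_pos (hap : IsAperiodicNat p)
    (hp : MemLp (fun i : ℕ => (i : ℝ)) 2 p) : 0 < Var[fun i : ℕ => (i : ℝ); p] := by
  refine lt_of_le_of_ne (variance_nonneg _ _) fun h => ?_
  have h1 := ae_eq_integral_of_variance_eq_zero hp h.symm
  have h2 : ∀ j : ℕ, p {j} ≠ 0 → (j : ℝ) = p[fun i : ℕ => (i : ℝ)] := by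
    intro j hj
    by_contra hne
    refine hj (measure_mono_null ?_ (ae_iff.1 h1))
    rintro i rfl
    exact hne
  obtain ⟨a, ha, -⟩ := hap 0 2 le_rfl
  obtain ⟨i, hi, hi'⟩ := hap a 2 le_rfl
  have : (i : ℝ) = a := (h2 i hi).trans (h2 a ha).symm
  have : i = a := by exact_mod_cast this
  simp [this] at hi'

/-- Gaussian domination of the characteristic function of an aperiodic law on a period. -/
theorem exists_norm_charFun_natCast_le (hap : IsAperiodicNat p)
    (hp : MemLp (fun i : ℕ => (i : ℝ)) 2 p) :
    ∃ c > 0, ∀ t : ℝ, |t| ≤ Real.pi →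
      ‖charFun (p.map (Nat.cast : ℕ → ℝ)) t‖ ≤ Real.exp (-(c * t ^ 2)) := by
  obtain ⟨c, hc, δ, hδ, h⟩ := norm_charFun_natCast_le_of_variance hp (hap.variance_pos hp)
  have hK : IsCompact {t : ℝ | δ ≤ |t| ∧ |t| ≤ Real.pi} := by
    refine (isCompact_Icc (a := -Real.pi) (b := Real.pi)).of_isClosed_subset ?_ ?_
    · exact (isClosed_le continuous_const continuous_abs).inter
        (isClosed_le continuous_abs continuous_const)
    · intro t ht
      exact abs_le.1 ht.2
  -- Away from `0`, the modulus is below `1` on a compact set, hence uniformly so.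
  obtain ⟨ρ, hρ1, hρ⟩ : ∃ ρ < 1, ∀ t : ℝ, δ ≤ |t| → |t| ≤ Real.pi →
      ‖charFun (p.map (Nat.cast : ℕ → ℝ)) t‖ ≤ ρ := by
    rcases Set.eq_empty_or_nonempty {t : ℝ | δ ≤ |t| ∧ |t| ≤ Real.pi} with he | hne
    · refine ⟨0, one_pos, fun t h1 h2 => ?_⟩
      have : t ∈ {t : ℝ | δ ≤ |t| ∧ |t| ≤ Real.pi} := ⟨h1, h2⟩
      simp [he] at this
    · obtain ⟨x, hx, hmax⟩ := hK.exists_isMaxOn hne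
        (continuous_charFun_natCast (p := p)).norm.continuousOn
      refine ⟨_, norm_charFun_natCast_lt_one hap ?_ hx.2, fun t h1 h2 => hmax ⟨h1, h2⟩⟩
      rintro rfl
      have := hx.1
      simp at this
      linarith
  have hπ := Real.pi_pos
  -- With a rate of at most `(1 - ρ) / π²`, the Gaussian stays above `1 - (1 - ρ) = ρ` on the whole
  -- period.
  refine ⟨min c ((1 - ρ) / Real.pi ^ 2), lt_min hc (div_pos (by linarith) (by positivity)),
    fun t ht => ?_⟩
  rcases lt_or_ge |t| δ with h1 | h1
  · refine (h t h1).trans (Real.exp_le_exp.2 ?_)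
    have := mul_le_mul_of_nonneg_right (min_le_left c ((1 - ρ) / Real.pi ^ 2)) (sq_nonneg t)
    linarith
  · refine (hρ t h1 ht).trans ?_
    have h2 : t ^ 2 ≤ Real.pi ^ 2 := sq_le_sq' (abs_le.1 ht).1 (abs_le.1 ht).2
    have h3 : min c ((1 - ρ) / Real.pi ^ 2) * t ^ 2 ≤ 1 - ρ := by
      calc min c ((1 - ρ) / Real.pi ^ 2) * t ^ 2 ≤ ((1 - ρ) / Real.pi ^ 2) * Real.pi ^ 2 :=
            mul_le_mul (min_le_right _ _) h2 (sq_nonneg t)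
              (div_nonneg (by linarith) (by positivity))
        _ = 1 - ρ := by field_simp
    have := Real.add_one_le_exp (-(min c ((1 - ρ) / Real.pi ^ 2) * t ^ 2))
    linarith

end

/-! ### Local limit theorem for sums of two kinds of variables -/

theorem norm_pow_sub_pow_le_mul {a b : ℂ} (ha : ‖a‖ ≤ 1) (hb : ‖b‖ ≤ 1) (n : ℕ) :
    ‖a ^ n - b ^ n‖ ≤ n * ‖a - b‖ := by
  induction n with
  | zero => simp
  | succ n ih =>
    have : a ^ (n + 1) - b ^ (n + 1) = a * (a ^ n - b ^ n) + (a - b) * b ^ n := by ring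
    rw [this]
    refine (norm_add_le _ _).trans ?_
    rw [norm_mul, norm_mul, norm_pow]
    have h1 : ‖a‖ * ‖a ^ n - b ^ n‖ ≤ n * ‖a - b‖ :=
      (mul_le_of_le_one_left (norm_nonneg _) ha).trans ih
    have h2 : ‖a - b‖ * ‖b‖ ^ n ≤ ‖a - b‖ :=
      mul_le_of_le_one_right (norm_nonneg _) (pow_le_one₀ (norm_nonneg _) hb)
    push_cast
    linarith

theorem norm_exp_neg_ofReal_mul_I (x : ℝ) : ‖Complex.exp (-(x * Complex.I))‖ = 1 := by
  have := Complex.norm_exp_ofReal_mul_I (-x)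
  push_cast at this
  rwa [neg_mul] at this

theorem coeff_genFun_pow_mul_pow_nonneg (p q : Measure ℕ) (k m s : ℕ) :
    0 ≤ PowerSeries.coeff s (genFun p ^ k * genFun q ^ m) := by
  have hmul : ∀ f g : PowerSeries ℝ, (∀ i, 0 ≤ PowerSeries.coeff i f) →
      (∀ i, 0 ≤ PowerSeries.coeff i g) → ∀ i, 0 ≤ PowerSeries.coeff i (f * g) := by
    intro f g hf hg i
    rw [PowerSeries.coeff_mul]
    exact Finset.sum_nonneg fun kl _ => mul_nonneg (hf _) (hg _)
  have hpow : ∀ f : PowerSeries ℝ, (∀ i, 0 ≤ PowerSeries.coeff i f) →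
      ∀ k i, 0 ≤ PowerSeries.coeff i (f ^ k) := by
    intro f hf k
    induction k with
    | zero =>
      intro i
      rw [pow_zero, PowerSeries.coeff_one]
      split_ifs <;> norm_num
    | succ k ih => rw [pow_succ]; exact hmul _ _ ih hf
  refine hmul _ _ (hpow _ (fun i => ?_) k) (hpow _ (fun i => ?_) m) s <;>
  · rw [genFun, PowerSeries.coeff_mk]
    exact measureReal_nonneg

/-- All the decay comes from `p`; the factor of `q` is bounded by `1`, so `q` may be periodic. -/
theorem norm_fourier_integrand_le {p q : Measure ℕ} [IsProbabilityMeasure q] {c : ℝ}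
    (h : ∀ t : ℝ, |t| ≤ Real.pi → ‖charFun (p.map (Nat.cast : ℕ → ℝ)) t‖ ≤ Real.exp (-(c * t ^ 2)))
    (k m s : ℕ) {t : ℝ} (ht : |t| ≤ Real.pi) :
    ‖charFun (p.map (Nat.cast : ℕ → ℝ)) t ^ k * charFun (q.map (Nat.cast : ℕ → ℝ)) t ^ m *
      Complex.exp (-(t * s * Complex.I))‖ ≤ Real.exp (-(c * k) * t ^ 2) := by
  have h1 := norm_exp_neg_ofReal_mul_I (t * s)
  push_cast at h1
  rw [norm_mul, h1, mul_one, norm_mul, norm_pow, norm_pow]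
  have h2 : ‖charFun (q.map (Nat.cast : ℕ → ℝ)) t‖ ^ m ≤ 1 :=
    pow_le_one₀ (norm_nonneg _) (norm_charFun_le_one t)
  have h3 : ‖charFun (p.map (Nat.cast : ℕ → ℝ)) t‖ ^ k ≤ Real.exp (-(c * t ^ 2)) ^ k :=
    pow_le_pow_left₀ (norm_nonneg _) (h t ht) k
  rw [← Real.exp_nat_mul] at h3
  calc _ ≤ ‖charFun (p.map (Nat.cast : ℕ → ℝ)) t‖ ^ k :=
        mul_le_of_le_one_right (by positivity) h2
    _ ≤ _ := h3.trans (le_of_eq (by ring_nf))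

section

variable {p q : Measure ℕ} [IsProbabilityMeasure p] [IsProbabilityMeasure q]

/-- Central limit theorem for characteristic functions, along an arbitrary filter. -/
theorem tendsto_charFun_centered_pow (hp : MemLp (fun i : ℕ => (i : ℝ)) 2 p) {ι : Type*}
    {l : Filter ι} {t : ι → ℝ} {m : ι → ℕ} {w : ℝ} (ht : Tendsto t l (𝓝 0))
    (hm : Tendsto (fun j => m j * t j ^ 2) l (𝓝 w)) :
    Tendsto (fun j => (charFun (p.map (Nat.cast : ℕ → ℝ)) (t j) *
        Complex.exp (-(t j * (∫ i : ℕ, (i : ℝ) ∂p : ℝ) * Complex.I))) ^ m j) l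
      (𝓝 (Complex.exp (-(Var[fun i : ℕ => (i : ℝ); p] * w / 2)))) := by
  set μ : ℝ := ∫ i : ℕ, (i : ℝ) ∂p
  set v : ℝ := Var[fun i : ℕ => (i : ℝ); p]
  have hv : 0 ≤ v := variance_nonneg _ _
  set f := fun s : ℝ => charFun (p.map (Nat.cast : ℕ → ℝ)) s * Complex.exp (-(s * μ * Complex.I))
  have hf : ∀ s, ‖f s‖ ≤ 1 := by
    intro s
    have := norm_exp_neg_ofReal_mul_I (s * μ)
    push_cast at this
    simp only [f, norm_mul, this, mul_one]
    exact norm_charFun_le_one s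
  have he : ∀ s : ℝ, ‖Complex.exp (-(v * s ^ 2 / 2))‖ ≤ 1 := by
    intro s
    have : (-(v * s ^ 2 / 2) : ℂ) = ((-(v * s ^ 2 / 2) : ℝ) : ℂ) := by push_cast; ring
    rw [this, Complex.norm_exp_ofReal, Real.exp_le_one_iff]
    have := mul_nonneg hv (sq_nonneg s)
    linarith
  -- The powers differ by at most `m` times the difference of the bases, that is `m · o(t²)`, which
  -- vanishes since `m t²` converges.
  have h1 : Tendsto (fun j => f (t j) ^ m j - Complex.exp (-(v * t j ^ 2 / 2)) ^ m j) l (𝓝 0) := by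
    have ho := (isLittleO_charFun_centered hp).comp_tendsto ht
    have h2 : Tendsto (fun j => (m j : ℝ) * ‖f (t j) - Complex.exp (-(v * t j ^ 2 / 2))‖) l
        (𝓝 0) := by
      have h3 := (Asymptotics.isBigO_refl (fun j => (m j : ℝ)) l).mul_isLittleO ho.norm_left
      have h4 := h3.trans_isBigO (hm.isBigO_one ℝ)
      exact (Asymptotics.isLittleO_one_iff ℝ).1 h4
    refine squeeze_zero_norm (fun j => ?_) h2
    exact norm_pow_sub_pow_le_mul (hf _) (he _) _
  have h5 : Tendsto (fun j => Complex.exp (-(v * t j ^ 2 / 2)) ^ m j) l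
      (𝓝 (Complex.exp (-(v * w / 2)))) := by
    have h6 : Tendsto (fun j => ((m j * t j ^ 2 : ℝ) : ℂ)) l (𝓝 (w : ℂ)) :=
      (Complex.continuous_ofReal.tendsto w).comp hm
    have h7 := (Complex.continuous_exp.tendsto _).comp
      (((h6.const_mul (v : ℂ)).div_const 2).neg)
    refine h7.congr fun j => ?_
    simp only [Function.comp]
    rw [← Complex.exp_nat_mul]
    push_cast
    ring_nf
  have := h1.add h5
  simpa using this

theorem integral_gaussian_char {v : ℝ} (hv : 0 < v) (x : ℝ) :
    ∫ u : ℝ, Complex.exp (-(v * u ^ 2 / 2)) * Complex.exp (-(u * x * Complex.I)) =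
      ((2 * Real.pi * ((√(2 * Real.pi * v))⁻¹ * Real.exp (-(x ^ 2 / (2 * v)))) : ℝ) : ℂ) := by
  have h := fourierIntegral_gaussian (b := ((v / 2 : ℝ) : ℂ)) (by simpa using hv) (-x : ℂ)
  have e : ∀ u : ℝ, Complex.exp (-(v * u ^ 2 / 2)) * Complex.exp (-(u * x * Complex.I)) =
      Complex.exp (Complex.I * -x * u) * Complex.exp (-((v / 2 : ℝ) : ℂ) * u ^ 2) := by
    intro u
    rw [mul_comm]
    push_cast
    ring_nf
  simp only [e]
  rw [h]
  have h1 : ((Real.pi : ℂ) / ((v / 2 : ℝ) : ℂ)) ^ (1 / 2 : ℂ) =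
      ((2 * Real.pi * (√(2 * Real.pi * v))⁻¹ : ℝ) : ℂ) := by
    have : (1 / 2 : ℂ) = ((1 / 2 : ℝ) : ℂ) := by push_cast; rfl
    rw [← Complex.ofReal_div, this, ← Complex.ofReal_cpow (by positivity), ← Real.sqrt_eq_rpow]
    congr 1
    rw [Real.sqrt_eq_iff_mul_self_eq_of_pos (by positivity), ← pow_two, mul_pow, inv_pow, Real.sq_sqrt (by positivity)]
    field_simp
  rw [h1]
  have h2 : (-(-x : ℂ) ^ 2 / (4 * ((v / 2 : ℝ) : ℂ))) = ((-(x ^ 2 / (2 * v)) : ℝ) : ℂ) := by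
    push_cast
    field_simp
    ring
  rw [h2, ← Complex.ofReal_exp]
  push_cast
  ring

/-- The Fourier integrand is below `exp (-c k t²)`, whose integral is `√(π / (c k))`. Uniformity in
all three parameters is what later permits domination over all tree sizes. -/
theorem exists_sqrt_mul_coeff_le (hap : IsAperiodicNat p)
    (hp : MemLp (fun i : ℕ => (i : ℝ)) 2 p) :
    ∃ C : ℝ, ∀ k m s : ℕ, √k * PowerSeries.coeff s (genFun p ^ k * genFun q ^ m) ≤ C := by
  obtain ⟨c, hc, h⟩ := exists_norm_charFun_natCast_le hap hp
  refine ⟨(2 * Real.pi)⁻¹ * √(Real.pi / c), fun k m s => ?_⟩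
  have hπ := Real.pi_pos
  rcases Nat.eq_zero_or_pos k with rfl | hk
  · rw [Nat.cast_zero, Real.sqrt_zero, zero_mul]
    positivity
  have hk' : (0 : ℝ) < k := by exact_mod_cast hk
  have h1 := congrArg norm (coeff_genFun_pow_mul_pow p q k m s)
  rw [Complex.norm_real, Real.norm_of_nonneg (coeff_genFun_pow_mul_pow_nonneg p q k m s),
    norm_mul] at h1
  have hint := integrable_exp_neg_mul_sq (b := c * k) (by positivity)
  have h2 : ‖∫ t in -Real.pi..Real.pi, charFun (p.map (Nat.cast : ℕ → ℝ)) t ^ k *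
        charFun (q.map (Nat.cast : ℕ → ℝ)) t ^ m * Complex.exp (-(t * s * Complex.I))‖ ≤
      ∫ t : ℝ, Real.exp (-(c * k) * t ^ 2) := by
    refine (intervalIntegral.norm_integral_le_of_norm_le (g := fun t =>
      Real.exp (-(c * k) * t ^ 2)) (by linarith) ?_ hint.intervalIntegrable).trans ?_
    · refine ae_of_all _ fun t ht => norm_fourier_integrand_le h k m s ?_
      exact abs_le.2 ⟨ht.1.le, ht.2⟩
    · rw [intervalIntegral.integral_of_le (by linarith)]
      exact setIntegral_le_integral hint (ae_of_all _ fun t => (Real.exp_pos _).le)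
  rw [integral_gaussian] at h2
  have h3 : ‖(2 * Real.pi : ℂ)⁻¹‖ = (2 * Real.pi)⁻¹ := by
    rw [norm_inv, norm_mul, Complex.norm_real, Real.norm_of_nonneg hπ.le]; simp
  rw [h1, h3]
  have h4 : √k * √(Real.pi / (c * k)) = √(Real.pi / c) := by
    rw [← Real.sqrt_mul hk'.le]
    congr 1
    field_simp
  calc _ ≤ √k * ((2 * Real.pi)⁻¹ * √(Real.pi / (c * k))) := by gcongr
    _ = _ := by rw [← h4]; ring

/-- Substituting `t = u / √k` absorbs the factor `√k`; the indicator moves the growing interval into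
the integrand, ready for dominated convergence. -/
theorem sqrt_mul_coeff_eq_integral {k : ℕ} (hk : 0 < k) (m s : ℕ) :
    ((√k * PowerSeries.coeff s (genFun p ^ k * genFun q ^ m) : ℝ) : ℂ) =
      (2 * Real.pi : ℂ)⁻¹ * ∫ u : ℝ, (Set.Ioc (-Real.pi * √k) (Real.pi * √k)).indicator
        (fun u : ℝ => charFun (p.map (Nat.cast : ℕ → ℝ)) (u / √k) ^ k *
          charFun (q.map (Nat.cast : ℕ → ℝ)) (u / √k) ^ m *
            Complex.exp (-((u / √k : ℝ) * s * Complex.I))) u := by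
  have hk' : (0 : ℝ) < √k := by simpa using hk
  have hπ := Real.pi_pos
  rw [integral_indicator measurableSet_Ioc, ← intervalIntegral.integral_of_le (by nlinarith),
    intervalIntegral.integral_comp_div (a := -Real.pi * √k) (b := Real.pi * √k) (c := √k)
    (fun t => charFun (p.map (Nat.cast : ℕ → ℝ)) t ^ k *
        charFun (q.map (Nat.cast : ℕ → ℝ)) t ^ m * Complex.exp (-(t * s * Complex.I))) hk'.ne',
    mul_div_cancel_right₀ _ hk'.ne', mul_div_cancel_right₀ _ hk'.ne', Complex.ofReal_mul,
    coeff_genFun_pow_mul_pow p q]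
  rw [Complex.real_smul]
  ring

/-- Local limit theorem for a sum of `k` variables of law `p` and `m` variables of law `q`. -/
theorem tendsto_sqrt_mul_coeff (hap : IsAperiodicNat p)
    (hp : MemLp (fun i : ℕ => (i : ℝ)) 2 p) (hq : MemLp (fun i : ℕ => (i : ℝ)) 2 q)
    {ι : Type*} {l : Filter ι} [l.IsCountablyGenerated] {k m s : ι → ℕ} {r x : ℝ} (hr : 0 ≤ r)
    (hk : Tendsto k l atTop) (hm : Tendsto (fun j => (m j : ℝ) / k j) l (𝓝 r))
    (hs : Tendsto (fun j => (s j - k j * ∫ i : ℕ, (i : ℝ) ∂p - m j * ∫ i : ℕ, (i : ℝ) ∂q) / √(k j))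
      l (𝓝 x)) {v : ℝ}
    (hv : v = Var[fun i : ℕ => (i : ℝ); p] + r * Var[fun i : ℕ => (i : ℝ); q]) :
    Tendsto (fun j => √(k j) * PowerSeries.coeff (s j) (genFun p ^ k j * genFun q ^ m j)) l
      (𝓝 ((√(2 * Real.pi * v))⁻¹ * Real.exp (-(x ^ 2 / (2 * v))))) := by
  have hπ := Real.pi_pos
  have hv0 : 0 < v := by
    have h1 := hap.variance_pos hp
    have h2 := mul_nonneg hr (variance_nonneg (fun i : ℕ => (i : ℝ)) q)
    linarith
  obtain ⟨c, hc, hbd⟩ := exists_norm_charFun_natCast_le hap hp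
  have hsqrt : Tendsto (fun j => √(k j : ℝ)) l atTop :=
    Real.tendsto_sqrt_atTop.comp (tendsto_natCast_atTop_atTop.comp hk)
  have hkpos : ∀ᶠ j in l, 0 < k j := hk.eventually_gt_atTop 0
  have key : Tendsto (fun j => ∫ u : ℝ,
      (Set.Ioc (-Real.pi * √(k j)) (Real.pi * √(k j))).indicator
        (fun u : ℝ => charFun (p.map (Nat.cast : ℕ → ℝ)) (u / √(k j)) ^ k j *
          charFun (q.map (Nat.cast : ℕ → ℝ)) (u / √(k j)) ^ m j *
            Complex.exp (-((u / √(k j) : ℝ) * s j * Complex.I))) u) l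
      (𝓝 (∫ u : ℝ, Complex.exp (-(v * u ^ 2 / 2)) * Complex.exp (-(u * x * Complex.I)))) := by
    refine tendsto_integral_filter_of_dominated_convergence (fun u => Real.exp (-c * u ^ 2))
      ?_ ?_ (integrable_exp_neg_mul_sq hc) ?_
    · refine Eventually.of_forall fun j => ?_
      refine AEStronglyMeasurable.indicator (Continuous.aestronglyMeasurable ?_) measurableSet_Ioc
      have h1 := (continuous_charFun_natCast (p := p)).comp (continuous_id.div_const √(k j : ℝ))
      have h2 := (continuous_charFun_natCast (p := q)).comp (continuous_id.div_const √(k j : ℝ))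
      simp only [Function.comp_def, id] at h1 h2
      fun_prop
    · filter_upwards [hkpos] with j hj
      have hj' : (0 : ℝ) < √(k j) := by simpa using hj
      refine ae_of_all _ fun u => ?_
      by_cases hu : u ∈ Set.Ioc (-Real.pi * √(k j)) (Real.pi * √(k j))
      · rw [Set.indicator_of_mem hu]
        refine (norm_fourier_integrand_le hbd (k j) (m j) (s j) ?_).trans (le_of_eq ?_)
        · rw [abs_le]
          constructor
          · rw [le_div_iff₀ hj']; exact hu.1.le
          · rw [div_le_iff₀ hj']; exact hu.2
        · rw [div_pow, Real.sq_sqrt (by positivity)]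
          have : (k j : ℝ) ≠ 0 := by exact_mod_cast hj.ne'
          congr 1
          field_simp
      · rw [Set.indicator_of_notMem hu, norm_zero]
        positivity
    · refine ae_of_all _ fun u => ?_
      have ht : Tendsto (fun j => u / √(k j : ℝ)) l (𝓝 0) := hsqrt.const_div_atTop u
      have hsq : ∀ᶠ j in l, (k j : ℝ) * (u / √(k j : ℝ)) ^ 2 = u ^ 2 := by
        filter_upwards [hkpos] with j hj
        have : (k j : ℝ) ≠ 0 := by exact_mod_cast hj.ne'
        rw [div_pow, Real.sq_sqrt (by positivity)]
        field_simp
      have h1 := tendsto_charFun_centered_pow hp ht (m := k) (w := u ^ 2)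
        (tendsto_const_nhds.congr' (hsq.mono fun _ h => h.symm))
      have h2 := tendsto_charFun_centered_pow hq ht (m := m) (w := r * u ^ 2) (by
        refine (hm.mul_const (u ^ 2)).congr' ?_
        filter_upwards [hkpos] with j hj
        have : (k j : ℝ) ≠ 0 := by exact_mod_cast hj.ne'
        rw [div_pow, Real.sq_sqrt (by positivity)]
        field_simp)
      have h3 : Tendsto (fun j => Complex.exp (-((u * ((s j - k j * ∫ i : ℕ, (i : ℝ) ∂p -
          m j * ∫ i : ℕ, (i : ℝ) ∂q) / √(k j)) : ℝ) * Complex.I))) l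
          (𝓝 (Complex.exp (-((u * x : ℝ) * Complex.I)))) := by
        have : Continuous fun y : ℝ => Complex.exp (-((u * y : ℝ) * Complex.I)) := by fun_prop
        exact (this.tendsto x).comp hs
      have h4 := (h1.mul h2).mul h3
      have e : Complex.exp (-(Var[fun i : ℕ => (i : ℝ); p] * (u ^ 2 : ℝ) / 2)) *
          Complex.exp (-(Var[fun i : ℕ => (i : ℝ); q] * (r * u ^ 2 : ℝ) / 2)) *
          Complex.exp (-((u * x : ℝ) * Complex.I)) =
          Complex.exp (-(v * u ^ 2 / 2)) * Complex.exp (-(u * x * Complex.I)) := by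
        rw [← Complex.exp_add, hv]
        push_cast
        ring_nf
      rw [e] at h4
      refine h4.congr' ?_
      have hmem : ∀ᶠ j in l, |u| < Real.pi * √(k j) :=
        (hsqrt.const_mul_atTop hπ).eventually_gt_atTop _
      filter_upwards [hmem, hkpos] with j hj hj0
      have hu := abs_lt.1 hj
      have hmem' : u ∈ Set.Ioc (-Real.pi * √(k j : ℝ)) (Real.pi * √(k j : ℝ)) :=
        ⟨by linarith [hu.1], hu.2.le⟩
      rw [Set.indicator_of_mem hmem', mul_pow, mul_pow,
        ← Complex.exp_nat_mul, ← Complex.exp_nat_mul]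
      set mp := ∫ i : ℕ, (i : ℝ) ∂p
      set mq := ∫ i : ℕ, (i : ℝ) ∂q
      -- The phase at `s j` splits into the centerings of the two groups of variables and the
      -- rescaled deviation, which converges by `hs`.
      have e2 : Complex.exp (-((u / √(k j) : ℝ) * s j * Complex.I)) =
          Complex.exp (k j * -((u / √(k j) : ℝ) * mp * Complex.I)) *
          Complex.exp (m j * -((u / √(k j) : ℝ) * mq * Complex.I)) *
          Complex.exp (-((u * ((s j - k j * mp - m j * mq) / √(k j)) : ℝ) * Complex.I)) := by
        rw [← Complex.exp_add, ← Complex.exp_add]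
        push_cast
        ring_nf
      rw [e2]
      ring
  rw [integral_gaussian_char hv0] at key
  have h5 := key.const_mul (2 * Real.pi : ℂ)⁻¹
  have h6 : (2 * Real.pi : ℂ)⁻¹ * ((2 * Real.pi * ((√(2 * Real.pi * v))⁻¹ *
      Real.exp (-(x ^ 2 / (2 * v)))) : ℝ) : ℂ) =
      (((√(2 * Real.pi * v))⁻¹ * Real.exp (-(x ^ 2 / (2 * v))) : ℝ) : ℂ) := by
    have : (Real.pi : ℂ) ≠ 0 := by exact_mod_cast hπ.ne'
    push_cast
    field_simp
  rw [h6] at h5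
  have h7 : Tendsto (fun j => ((√(k j) * PowerSeries.coeff (s j)
      (genFun p ^ k j * genFun q ^ m j) : ℝ) : ℂ)) l
      (𝓝 (((√(2 * Real.pi * v))⁻¹ * Real.exp (-(x ^ 2 / (2 * v))) : ℝ) : ℂ)) := by
    refine h5.congr' ?_
    filter_upwards [hkpos] with j hj
    rw [sqrt_mul_coeff_eq_integral hj]
  have h8 := (Complex.continuous_re.tendsto _).comp h7
  simpa only [Function.comp_def, Complex.ofReal_re] using h8

end

section

variable {p q : Measure ℕ} [IsProbabilityMeasure p] [IsProbabilityMeasure q]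

/-- Local limit theorem for a sum of `k` variables of law `p` and `m` variables of law `q`,
one of which is aperiodic. -/
theorem tendsto_sqrt_mul_coeff_of_or (hap : IsAperiodicNat p ∨ IsAperiodicNat q)
    (hp : MemLp (fun i : ℕ => (i : ℝ)) 2 p) (hq : MemLp (fun i : ℕ => (i : ℝ)) 2 q)
    {ι : Type*} {l : Filter ι} [l.IsCountablyGenerated] {k m s : ι → ℕ} {r x : ℝ} (hr : 0 < r)
    (hk : Tendsto k l atTop) (hm : Tendsto (fun j => (m j : ℝ) / k j) l (𝓝 r))
    (hs : Tendsto (fun j => (s j - k j * ∫ i : ℕ, (i : ℝ) ∂p - m j * ∫ i : ℕ, (i : ℝ) ∂q) / √(k j))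
      l (𝓝 x)) {v : ℝ}
    (hv : v = Var[fun i : ℕ => (i : ℝ); p] + r * Var[fun i : ℕ => (i : ℝ); q]) :
    Tendsto (fun j => √(k j) * PowerSeries.coeff (s j) (genFun p ^ k j * genFun q ^ m j)) l
      (𝓝 ((√(2 * Real.pi * v))⁻¹ * Real.exp (-(x ^ 2 / (2 * v))))) := by
  rcases hap with hap | hap
  · exact tendsto_sqrt_mul_coeff hap hp hq hr.le hk hm hs hv
  -- When `q` is the aperiodic law the roles are exchanged: `√m` becomes the scale, so `r`, `x`, `v`
  -- turn into `r⁻¹`, `x / √r`, `v / r`.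
  have hkR : Tendsto (fun j => (k j : ℝ)) l atTop := tendsto_natCast_atTop_atTop.comp hk
  have hk0 : ∀ᶠ j in l, (0 : ℝ) < k j := hkR.eventually_gt_atTop 0
  have hmR : Tendsto (fun j => (m j : ℝ)) l atTop := by
    refine (hm.pos_mul_atTop hr hkR).congr' ?_
    filter_upwards [hk0] with j hj
    field_simp
  have hm0 : ∀ᶠ j in l, (0 : ℝ) < m j := hmR.eventually_gt_atTop 0
  have hkm : Tendsto (fun j => (k j : ℝ) / m j) l (𝓝 r⁻¹) := by
    refine (hm.inv₀ hr.ne').congr fun j => ?_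
    rw [inv_div]
  have hsq : Tendsto (fun j => √(k j : ℝ) / √(m j)) l (𝓝 (√r)⁻¹) := by
    rw [← Real.sqrt_inv]
    refine ((Real.continuous_sqrt.tendsto _).comp hkm).congr fun j => ?_
    simp [Real.sqrt_div]
  have hv' : v / r = Var[fun i : ℕ => (i : ℝ); q] + r⁻¹ * Var[fun i : ℕ => (i : ℝ); p] := by
    rw [hv]; field_simp; ring
  have hvpos : 0 < v := by
    have h1 := hap.variance_pos hq
    have h2 := variance_nonneg (fun i : ℕ => (i : ℝ)) p
    have := mul_pos hr h1
    linarith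
  have h := tendsto_sqrt_mul_coeff (x := x * (√r)⁻¹) (s := s) hap hq hp (inv_pos.2 hr).le
    (tendsto_natCast_atTop_iff.1 hmR) hkm (by
      refine (hs.mul hsq).congr' ?_
      filter_upwards [hk0] with j hj
      have : √(k j : ℝ) ≠ 0 := (Real.sqrt_pos.2 hj).ne'
      field_simp
      ring) hv'
  have h2 := hsq.mul h
  have e : (√r)⁻¹ * ((√(2 * Real.pi * (v / r)))⁻¹ *
      Real.exp (-((x * (√r)⁻¹) ^ 2 / (2 * (v / r))))) =
      (√(2 * Real.pi * v))⁻¹ * Real.exp (-(x ^ 2 / (2 * v))) := by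
    rw [← mul_assoc, ← mul_inv, ← Real.sqrt_mul hr.le, mul_pow, inv_pow, Real.sq_sqrt hr.le]
    have e1 : r * (2 * Real.pi * (v / r)) = 2 * Real.pi * v := by field_simp
    have e2 : x ^ 2 * r⁻¹ / (2 * (v / r)) = x ^ 2 / (2 * v) := by field_simp
    rw [e1, e2]
  rw [e] at h2
  refine h2.congr' ?_
  filter_upwards [hm0] with j hj
  have : √(m j : ℝ) ≠ 0 := (Real.sqrt_pos.2 hj).ne'
  rw [mul_comm (genFun p ^ k j)]
  field_simp

theorem coeff_genFun_pow_mul_pow_le_one (k m s : ℕ) :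
    PowerSeries.coeff s (genFun p ^ k * genFun q ^ m) ≤ 1 := by
  have h1 := congrArg norm (coeff_genFun_pow_mul_pow p q k m s)
  have hπ := Real.pi_pos
  rw [Complex.norm_real, Real.norm_of_nonneg (coeff_genFun_pow_mul_pow_nonneg p q k m s),
    norm_mul] at h1
  have h3 : ‖(2 * Real.pi : ℂ)⁻¹‖ = (2 * Real.pi)⁻¹ := by
    rw [norm_inv, norm_mul, Complex.norm_real, Real.norm_of_nonneg hπ.le]; simp
  have h2 := intervalIntegral.norm_integral_le_of_norm_le_const (a := -Real.pi) (b := Real.pi)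
    (C := 1) (f := fun t : ℝ => charFun (p.map (Nat.cast : ℕ → ℝ)) t ^ k *
        charFun (q.map (Nat.cast : ℕ → ℝ)) t ^ m * Complex.exp (-(t * s * Complex.I)))
    (fun t ht => by
      rw [Set.uIoc_of_le (by linarith)] at ht
      -- With `c = 0` the Gaussian bound degenerates to the trivial bound by `1`.
      simpa using norm_fourier_integrand_le (p := p) (q := q) (c := 0)
        (fun t _ => by simpa using norm_charFun_le_one t) k m s (abs_le.2 ⟨ht.1.le, ht.2⟩))
  rw [h1, h3, inv_mul_le_iff₀ (by positivity)]
  refine h2.trans (le_of_eq ?_)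
  rw [abs_of_nonneg (by linarith)]
  ring

/-- If only `q` is aperiodic, the natural bound has `√m` in place of `√k`. The conversion costs `√(k
/ (m + 1)) ≤ 1 + k / (m + 1)`, a rational form that the negative binomial weights absorb exactly
(`nbWeight_mul_div`); the `+ 1` covers `m = 0`. -/
theorem exists_sqrt_mul_coeff_le_of_or (hap : IsAperiodicNat p ∨ IsAperiodicNat q)
    (hp : MemLp (fun i : ℕ => (i : ℝ)) 2 p) (hq : MemLp (fun i : ℕ => (i : ℝ)) 2 q) :
    ∃ C : ℝ, 0 ≤ C ∧ ∀ k m s : ℕ, √k * PowerSeries.coeff s (genFun p ^ k * genFun q ^ m) ≤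
      C * (1 + k / (m + 1)) := by
  rcases hap with hap | hap
  · obtain ⟨C, hC⟩ := exists_sqrt_mul_coeff_le (q := q) hap hp
    have hC0 : 0 ≤ C := by simpa using hC 0 0 0
    refine ⟨C, hC0, fun k m s => (hC k m s).trans ?_⟩
    refine le_mul_of_one_le_right hC0 ?_
    have : (0 : ℝ) ≤ k / (m + 1) := by positivity
    linarith
  · obtain ⟨C, hC⟩ := exists_sqrt_mul_coeff_le (q := p) hap hq
    have hC0 : 0 ≤ C := by simpa using hC 0 0 0
    refine ⟨C + 1, by linarith, fun k m s => ?_⟩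
    have h0 := coeff_genFun_pow_mul_pow_nonneg p q k m s
    have h1 := coeff_genFun_pow_mul_pow_le_one (p := p) (q := q) k m s
    have h2 := hC m k s
    rw [mul_comm (genFun q ^ m)] at h2
    set a := PowerSeries.coeff s (genFun p ^ k * genFun q ^ m)
    have hm : √((m : ℝ) + 1) ≤ √m + 1 := by
      rw [Real.sqrt_le_left (by positivity)]
      nlinarith [Real.sq_sqrt (Nat.cast_nonneg (α := ℝ) m), Real.sqrt_nonneg (m : ℝ)]
    have hk : √(k : ℝ) ≤ √((m : ℝ) + 1) * (1 + k / (m + 1)) := by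
      have h3 : √(k : ℝ) = √((m : ℝ) + 1) * √((k : ℝ) / (m + 1)) := by
        rw [← Real.sqrt_mul (by positivity)]
        congr 1
        field_simp
      rw [h3]
      refine mul_le_mul_of_nonneg_left ?_ (Real.sqrt_nonneg _)
      have h4 : (0 : ℝ) ≤ (k : ℝ) / (m + 1) := by positivity
      nlinarith [Real.sq_sqrt h4, sq_nonneg (√((k : ℝ) / (m + 1)) - 1)]
    have hpos : (0 : ℝ) ≤ 1 + k / (m + 1) := by positivity
    calc √k * a ≤ (√((m : ℝ) + 1) * (1 + k / (m + 1))) * a := by gcongr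
      _ ≤ ((√m + 1) * (1 + k / (m + 1))) * a := by gcongr
      _ = (√m * a + a) * (1 + k / (m + 1)) := by ring
      _ ≤ (C + 1) * (1 + k / (m + 1)) := by gcongr

end

/-! ### Passing to the limit in sums over the integers -/

/-- Dominated convergence with varying dominating functions. -/
theorem tendsto_integral_of_varying_domination {α : Type*} [MeasurableSpace α] {μ : Measure α}
    {F G : ℕ → α → ℝ} {f g : α → ℝ} (hF : ∀ k, AEStronglyMeasurable (F k) μ)
    (hG : ∀ᶠ k in atTop, Integrable (G k) μ) (hg : Integrable g μ)
    (hFG : ∀ᶠ k in atTop, ∀ x, |F k x| ≤ G k x)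
    (hFf : ∀ x, Tendsto (fun k => F k x) atTop (𝓝 (f x)))
    (hGg : ∀ x, Tendsto (fun k => G k x) atTop (𝓝 (g x)))
    (hint : Tendsto (fun k => ∫ x, G k x ∂μ) atTop (𝓝 (∫ x, g x ∂μ))) :
    Tendsto (fun k => ∫ x, F k x ∂μ) atTop (𝓝 (∫ x, f x ∂μ)) := by
  have hg0 : ∀ x, 0 ≤ g x := fun x => ge_of_tendsto (hGg x) (hFG.mono fun k h =>
    (abs_nonneg _).trans (h x))
  have hfg : ∀ x, |f x| ≤ g x := fun x => le_of_tendsto_of_tendsto (hFf x).abs (hGg x)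
    (hFG.mono fun k h => h x)
  have hmin : Tendsto (fun k => ∫ x, min (G k x) (g x) ∂μ) atTop (𝓝 (∫ x, g x ∂μ)) := by
    refine tendsto_integral_filter_of_dominated_convergence g ?_ ?_ hg ?_
    · filter_upwards [hG] with k hk
      exact (hk.inf hg).aestronglyMeasurable
    · filter_upwards [hFG] with k hk
      refine ae_of_all _ fun x => ?_
      rw [Real.norm_of_nonneg (le_min ((abs_nonneg _).trans (hk x)) (hg0 x))]
      exact min_le_right _ _
    · refine ae_of_all _ fun x => ?_
      simpa using (hGg x).min (tendsto_const_nhds (x := g x))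
  -- Scheffé's argument: `|G - g| = G + g - 2 min (G, g)`, and the minimum is dominated by `g`.
  have hL1 : Tendsto (fun k => ∫ x, |G k x - g x| ∂μ) atTop (𝓝 0) := by
    have h := (hint.add (tendsto_const_nhds (x := ∫ x, g x ∂μ))).sub (hmin.const_mul 2)
    have e : (∫ x, g x ∂μ) + (∫ x, g x ∂μ) - 2 * (∫ x, g x ∂μ) = 0 := by ring
    rw [e] at h
    refine h.congr' ?_
    filter_upwards [hG] with k hk
    have h1 : Integrable (fun x => G k x + g x) μ := hk.add hg
    have h2 : Integrable (fun x => 2 * min (G k x) (g x)) μ := (hk.inf hg).const_mul 2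
    rw [← integral_const_mul, ← integral_add hk hg, ← integral_sub h1 h2]
    refine integral_congr_ae (ae_of_all _ fun x => ?_)
    simp only
    rcases le_total (G k x) (g x) with h | h
    · rw [min_eq_left h, abs_of_nonpos (by linarith)]; ring
    · rw [min_eq_right h, abs_of_nonneg (by linarith)]; ring
  -- Truncating `F k` to `[-g, g]` allows ordinary dominated convergence; the truncation error is at
  -- most `|G k - g|`.
  have hcm : ∀ k, AEStronglyMeasurable (fun x => max (-g x) (min (g x) (F k x))) μ := fun k =>
    hg.aestronglyMeasurable.neg.sup (hg.aestronglyMeasurable.inf (hF k))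
  have hcb : ∀ k x, |max (-g x) (min (g x) (F k x))| ≤ g x := by
    intro k x
    rw [abs_le]
    exact ⟨le_max_left _ _, max_le (by linarith [hg0 x]) (min_le_left _ _)⟩
  have hclamp : Tendsto (fun k => ∫ x, max (-g x) (min (g x) (F k x)) ∂μ) atTop
      (𝓝 (∫ x, f x ∂μ)) := by
    refine tendsto_integral_of_dominated_convergence g hcm hg
      (fun k => ae_of_all _ fun x => hcb k x) (ae_of_all _ fun x => ?_)
    have h := (tendsto_const_nhds (x := -g x)).max
      ((tendsto_const_nhds (x := g x)).min (hFf x))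
    rwa [min_eq_right (abs_le.1 (hfg x)).2, max_eq_right (abs_le.1 (hfg x)).1] at h
  have hdiff : Tendsto (fun k => (∫ x, F k x ∂μ) - ∫ x, max (-g x) (min (g x) (F k x)) ∂μ) atTop
      (𝓝 0) := by
    refine squeeze_zero_norm' ?_ hL1
    filter_upwards [hG, hFG] with k hk hk2
    have hFi : Integrable (F k) μ := hk.mono' (hF k) (ae_of_all _ hk2)
    have hci : Integrable (fun x => max (-g x) (min (g x) (F k x))) μ :=
      hg.mono' (hcm k) (ae_of_all _ (hcb k))
    rw [← integral_sub hFi hci]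
    refine norm_integral_le_of_norm_le (hk.sub hg).abs (ae_of_all _ fun x => ?_)
    have h1 := abs_le.1 (hk2 x)
    have h0 := hg0 x
    rw [Real.norm_eq_abs, abs_le]
    have h2 := le_abs_self (G k x - g x)
    have h3 := abs_nonneg (G k x - g x)
    rcases le_total (g x) (F k x) with h | h
    · rw [min_eq_left h, max_eq_right (by linarith)]
      constructor <;> linarith
    · rw [min_eq_right h]
      rcases le_total (-g x) (F k x) with h' | h'
      · rw [max_eq_right h']
        constructor <;> linarith
      · rw [max_eq_left h']
        constructor <;> linarith
  simpa using hdiff.add hclamp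

theorem map_floor_volume : (volume : Measure ℝ).map (Int.floor : ℝ → ℤ) = Measure.count := by
  refine Measure.ext_of_singleton fun n => ?_
  rw [Measure.map_apply Int.measurable_floor (measurableSet_singleton n), Int.preimage_floor_singleton,
    Real.volume_Ico, Measure.count_singleton]
  simp

theorem integrable_floor_iff (u : ℤ → ℝ) :
    Integrable (fun x : ℝ => u ⌊x⌋) ↔ Summable u := by
  have h := integrable_map_measure (μ := (volume : Measure ℝ)) (f := (Int.floor : ℝ → ℤ)) (g := u)
    (Measurable.of_discrete.aestronglyMeasurable) Int.measurable_floor.aemeasurable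
  rw [map_floor_volume] at h
  rw [integrable_count_iff, summable_norm_iff] at h
  exact h.symm

theorem integral_floor {u : ℤ → ℝ} (hu : Summable u) : ∫ x : ℝ, u ⌊x⌋ = ∑' n, u n := by
  have h := integral_map (μ := (volume : Measure ℝ)) (φ := (Int.floor : ℝ → ℤ)) (f := u)
    Int.measurable_floor.aemeasurable (Measurable.of_discrete.aestronglyMeasurable)
  rw [map_floor_volume, integral_countable (integrable_count_iff.2 hu.norm)] at h
  rw [← h]
  simp

theorem integrable_floor_affine {u : ℤ → ℝ} (hu : Summable u) (a : ℝ) {c : ℝ} (hc : 0 < c) :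
    Integrable fun y : ℝ => u ⌊a + c * y⌋ :=
  (((integrable_floor_iff u).2 hu).comp_add_left a).comp_mul_left' hc.ne'

/-- A sum over the integers as an integral, each integer being replaced by a cell. -/
theorem integral_floor_affine {u : ℤ → ℝ} (hu : Summable u) (a : ℝ) {c : ℝ} (hc : 0 < c) :
    ∫ y : ℝ, c * u ⌊a + c * y⌋ = ∑' n, u n := by
  rw [integral_const_mul, Measure.integral_comp_mul_left (fun x => u ⌊a + x⌋),
    integral_add_left_eq_self (fun x => u ⌊x⌋), integral_floor hu, smul_eq_mul,
    abs_of_pos (inv_pos.2 hc), mul_inv_cancel_left₀ hc.ne']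

/-! ### Negative binomial weights and their local limit -/

/-- The negative binomial weights: the probability that the `k`-th success in a sequence of
independent trials with success probability `b` occurs at time `n`. -/
noncomputable def nbWeight (b : ℝ) (k n : ℕ) : ℝ :=
  (k : ℝ) / n * (n.choose k * b ^ k * (1 - b) ^ (n - k))

theorem nbWeight_nonneg {b : ℝ} (hb0 : 0 ≤ b) (hb1 : b ≤ 1) (k n : ℕ) : 0 ≤ nbWeight b k n := by
  have : 0 ≤ 1 - b := by linarith
  unfold nbWeight
  positivity

theorem nbWeight_of_lt (b : ℝ) {k n : ℕ} (h : n < k) : nbWeight b k n = 0 := by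
  simp [nbWeight, Nat.choose_eq_zero_of_lt h]

/-- Since `(k / n) C(n, k) = C(n - 1, k - 1)`, shifting `n` by `k` gives the expansion of `(1 - (1 -
b)) ^ (-k)`. -/
theorem hasSum_nbWeight {b : ℝ} (hb0 : 0 < b) (hb1 : b < 1) {k : ℕ} (hk : 0 < k) :
    HasSum (nbWeight b k) 1 := by
  obtain ⟨k, rfl⟩ : ∃ k', k = k' + 1 := ⟨k - 1, by omega⟩
  have h := (hasSum_choose_mul_geometric_of_norm_lt_one (𝕜 := ℝ) k (r := 1 - b) (by
    rw [Real.norm_eq_abs, abs_lt]; constructor <;> linarith)).mul_left (b ^ (k + 1))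
  have e : b ^ (k + 1) * (1 / (1 - (1 - b)) ^ (k + 1)) = 1 := by
    rw [sub_sub_cancel]; field_simp
  rw [e] at h
  refine (Function.Injective.hasSum_iff (g := fun j => j + (k + 1))
    (add_left_injective (k + 1)) ?_).1 ?_
  · intro n hn
    refine nbWeight_of_lt b ?_
    by_contra hlt
    exact hn ⟨n - (k + 1), by simp only; omega⟩
  · refine h.congr_fun fun j => ?_
    have h1 := Nat.add_one_mul_choose_eq (j + k) k
    have h2 : ((j : ℝ) + k + 1) * (j + k).choose k = (j + k + 1).choose (k + 1) * (k + 1) := by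
      exact_mod_cast h1
    have h4 : j + k + 1 - (k + 1) = j := by omega
    simp only [Function.comp_apply, nbWeight, h4, ← Nat.add_assoc]
    push_cast
    have h3 : (j : ℝ) + k + 1 ≠ 0 := by positivity
    field_simp
    linear_combination -(1 - b) ^ j * h2

/-- From `C(n, k) k = C(n, k - 1) (n - k + 1)`: the unbounded factor `k / (n - k + 1)` merely
replaces `k` by `k - 1`, so the total mass stays explicit. -/
theorem nbWeight_mul_div {b : ℝ} (hb1 : b < 1) {k n : ℕ} (hk : 2 ≤ k)
    (hkn : k ≤ n) :
    nbWeight b k n * (k / ((n - k : ℕ) + 1)) =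
      k / (k - 1) * (b / (1 - b)) * nbWeight b (k - 1) n := by
  obtain ⟨k, rfl⟩ : ∃ k', k = k' + 2 := ⟨k - 2, by omega⟩
  obtain ⟨m, rfl⟩ : ∃ m, n = k + 2 + m := ⟨n - (k + 2), by omega⟩
  have h1 := Nat.choose_succ_right_eq (k + 2 + m) (k + 1)
  have e1 : k + 2 + m - (k + 1) = m + 1 := by omega
  have e2 : k + 2 + m - (k + 2) = m := by omega
  have e3 : k + 2 - 1 = k + 1 := by omega
  rw [e1] at h1
  have h2 : ((k + 2 + m).choose (k + 2) : ℝ) * (k + 2) = (k + 2 + m).choose (k + 1) * (m + 1) := by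
    have : (((k + 2 + m).choose (k + 1 + 1) * (k + 1 + 1) : ℕ) : ℝ) =
      ((k + 2 + m).choose (k + 1) * (m + 1) : ℕ) := by rw [h1]
    push_cast at this
    have e4 : k + 1 + 1 = k + 2 := rfl
    rw [e4] at this
    linear_combination this
  simp only [nbWeight, e3, e1, e2]
  push_cast
  have hb : 1 - b ≠ 0 := by linarith
  have h3 : (k : ℝ) + 2 + m ≠ 0 := by positivity
  have h4 : (m : ℝ) + 1 ≠ 0 := by positivity
  have h5 : (k : ℝ) + 2 - 1 = k + 1 := by ring
  have h6 : ((k + 2 + m).choose (k + 2) : ℝ) =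
      (k + 2 + m).choose (k + 1) * (m + 1) / (k + 2) := by
    rw [← h2, mul_div_cancel_right₀]
    positivity
  rw [h5, h6]
  field_simp
  ring

/-- The Bernoulli law on `{0, 1} ⊆ ℕ`. -/
noncomputable def bernoulliNat (b : ℝ) : Measure ℕ :=
  ENNReal.ofReal (1 - b) • Measure.dirac 0 + ENNReal.ofReal b • Measure.dirac 1

theorem isProbabilityMeasure_bernoulliNat {b : ℝ} (hb0 : 0 < b) (hb1 : b < 1) :
    IsProbabilityMeasure (bernoulliNat b) := by
  constructor
  simp only [bernoulliNat, Measure.coe_add, Measure.coe_smul, Pi.add_apply, Pi.smul_apply,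
    measure_univ, smul_eq_mul, mul_one]
  rw [← ENNReal.ofReal_add (by linarith) hb0.le]
  simp

theorem integral_bernoulliNat {b : ℝ} (hb0 : 0 < b) (hb1 : b < 1) (f : ℕ → ℝ) :
    ∫ i, f i ∂(bernoulliNat b) = (1 - b) * f 0 + b * f 1 := by
  have h : ∀ (c : ℝ) (i : ℕ), Integrable f (ENNReal.ofReal c • Measure.dirac i) := fun c i =>
    (integrable_dirac (by simp)).smul_measure ENNReal.ofReal_ne_top
  rw [bernoulliNat, integral_add_measure (h _ _) (h _ _), integral_smul_measure,
    integral_smul_measure, integral_dirac, integral_dirac, ENNReal.toReal_ofReal (by linarith),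
    ENNReal.toReal_ofReal hb0.le, smul_eq_mul, smul_eq_mul]

theorem genFun_bernoulliNat {b : ℝ} (hb0 : 0 < b) (hb1 : b < 1) :
    genFun (bernoulliNat b) = PowerSeries.C b * PowerSeries.X + PowerSeries.C (1 - b) := by
  have := isProbabilityMeasure_bernoulliNat hb0 hb1
  ext i
  have h : (bernoulliNat b).real {i} = (1 - b) * ({i} : Set ℕ).indicator 1 0 +
      b * ({i} : Set ℕ).indicator 1 1 := by
    rw [← integral_bernoulliNat hb0 hb1, integral_indicator_one (measurableSet_singleton i)]
  rw [genFun, PowerSeries.coeff_mk, h, map_add, PowerSeries.coeff_C_mul, PowerSeries.coeff_X,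
    PowerSeries.coeff_C]
  rcases i with _ | _ | i <;> simp

/-- Binomial probabilities are thus coefficients of the kind already studied, and de Moivre–Laplace
becomes a case of `tendsto_sqrt_mul_coeff`. -/
theorem coeff_genFun_bernoulliNat_pow {b : ℝ} (hb0 : 0 < b) (hb1 : b < 1) (n k : ℕ) :
    PowerSeries.coeff k (genFun (bernoulliNat b) ^ n) =
      n.choose k * b ^ k * (1 - b) ^ (n - k) := by
  rw [genFun_bernoulliNat hb0 hb1, add_pow, map_sum]
  have h : ∀ m, PowerSeries.coeff k ((PowerSeries.C b * PowerSeries.X) ^ m *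
      PowerSeries.C (1 - b) ^ (n - m) * ((n.choose m : ℕ) : PowerSeries ℝ)) =
      if k = m then n.choose m * b ^ m * (1 - b) ^ (n - m) else 0 := by
    intro m
    have : (PowerSeries.C b * PowerSeries.X) ^ m * PowerSeries.C (1 - b) ^ (n - m) *
        ((n.choose m : ℕ) : PowerSeries ℝ) =
        PowerSeries.C (n.choose m * b ^ m * (1 - b) ^ (n - m)) * PowerSeries.X ^ m := by
      simp only [map_mul, map_pow, map_natCast]
      ring
    rw [this, PowerSeries.coeff_C_mul, PowerSeries.coeff_X_pow]
    split_ifs <;> simp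
  simp only [h, Finset.sum_ite_eq, Finset.mem_range]
  split_ifs with hk
  · rfl
  · rw [Nat.choose_eq_zero_of_lt (by omega)]
    simp

theorem isAperiodicNat_bernoulliNat {b : ℝ} (hb0 : 0 < b) (hb1 : b < 1) :
    IsAperiodicNat (bernoulliNat b) := by
  intro c d hd
  by_contra! h
  have h0 : d ∣ ((0 : ℕ) : ℤ) - c := h 0 (by simp [bernoulliNat, hb1])
  have h1 : d ∣ ((1 : ℕ) : ℤ) - c := h 1 (by simp [bernoulliNat, hb0])
  have h2 : d ∣ 1 := by
    have := dvd_sub h1 h0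
    simpa using this
  have := Int.le_of_dvd one_pos h2
  omega

theorem memLp_bernoulliNat (b : ℝ) :
    MemLp (fun i : ℕ => (i : ℝ)) 2 (bernoulliNat b) := by
  have h : ∀ (c : ℝ) (i : ℕ), Integrable (fun i : ℕ => (i : ℝ) ^ 2)
      (ENNReal.ofReal c • Measure.dirac i) := fun c i =>
    (integrable_dirac (by simp)).smul_measure ENNReal.ofReal_ne_top
  rw [memLp_two_iff_integrable_sq (by fun_prop)]
  exact (h _ _).add_measure (h _ _)

theorem variance_bernoulliNat {b : ℝ} (hb0 : 0 < b) (hb1 : b < 1) :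
    Var[fun i : ℕ => (i : ℝ); bernoulliNat b] = b * (1 - b) := by
  have := isProbabilityMeasure_bernoulliNat hb0 hb1
  rw [variance_eq_sub (memLp_bernoulliNat b), integral_bernoulliNat hb0 hb1,
    integral_bernoulliNat hb0 hb1]
  simp
  ring

section

variable {b : ℝ} {ι : Type*} {l : Filter ι} {k n : ι → ℕ} {y : ℝ}

theorem tendsto_div_of_tendsto_sub_div_sqrt (hk : Tendsto k l atTop)
    (hn : Tendsto (fun j => (n j - k j / b) / √(k j)) l (𝓝 y)) :
    Tendsto (fun j => (n j : ℝ) / k j) l (𝓝 b⁻¹) := by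
  have hkR : Tendsto (fun j => (k j : ℝ)) l atTop := tendsto_natCast_atTop_atTop.comp hk
  have hsq : Tendsto (fun j => √(k j : ℝ)) l atTop := Real.tendsto_sqrt_atTop.comp hkR
  have h := (hn.div_atTop hsq).add (tendsto_const_nhds (x := b⁻¹))
  rw [zero_add] at h
  refine h.congr' ?_
  filter_upwards [hkR.eventually_gt_atTop 0] with j hj
  rw [div_div, Real.mul_self_sqrt hj.le]
  field_simp
  ring

/-- Local limit theorem for the negative binomial law. -/
theorem tendsto_sqrt_mul_nbWeight [l.IsCountablyGenerated] (hb0 : 0 < b) (hb1 : b < 1)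
    (hk : Tendsto k l atTop)
    (hn : Tendsto (fun j => (n j - k j / b) / √(k j)) l (𝓝 y)) :
    Tendsto (fun j => √(k j) * nbWeight b (k j) (n j)) l
      (𝓝 (b * (√(2 * Real.pi * (1 - b)))⁻¹ * Real.exp (-(b ^ 2 * y ^ 2 / (2 * (1 - b)))))) := by
  have := isProbabilityMeasure_bernoulliNat hb0 hb1
  have hb1' : 0 < 1 - b := by linarith
  have hnk := tendsto_div_of_tendsto_sub_div_sqrt hk hn
  have hkR : Tendsto (fun j => (k j : ℝ)) l atTop := tendsto_natCast_atTop_atTop.comp hk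
  have hk0 : ∀ᶠ j in l, (0 : ℝ) < k j := hkR.eventually_gt_atTop 0
  have hnR : Tendsto (fun j => (n j : ℝ)) l atTop := by
    refine (hnk.pos_mul_atTop (inv_pos.2 hb0) hkR).congr' ?_
    filter_upwards [hk0] with j hj
    field_simp
  have hn0 : ∀ᶠ j in l, (0 : ℝ) < n j := hnR.eventually_gt_atTop 0
  have hkn : Tendsto (fun j => (k j : ℝ) / n j) l (𝓝 b) := by
    have := hnk.inv₀ (inv_pos.2 hb0).ne'
    rw [inv_inv] at this
    refine this.congr fun j => ?_
    rw [inv_div]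
  have hsq : Tendsto (fun j => √(k j : ℝ) / √(n j)) l (𝓝 √b) := by
    refine ((Real.continuous_sqrt.tendsto _).comp hkn).congr fun j => ?_
    simp [Real.sqrt_div]
  -- There are `n` Bernoulli summands and the value is `k`. As `k - b n = -b (n - k / b)` and `√k /
  -- √n → √b`, the deviation at scale `√n` is `-b y √b`.
  have h := tendsto_sqrt_mul_coeff (q := bernoulliNat b) (k := n) (m := fun _ => 0) (s := k)
    (r := 0) (x := -(b * (y * √b))) (v := b * (1 - b))
    (isAperiodicNat_bernoulliNat hb0 hb1) (memLp_bernoulliNat b) (memLp_bernoulliNat b)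
    le_rfl (tendsto_natCast_atTop_iff.1 hnR) (by simpa using tendsto_const_nhds) (by
      refine ((hn.mul hsq).const_mul b).neg.congr' ?_
      filter_upwards [hk0, hn0] with j hj hj'
      rw [integral_bernoulliNat hb0 hb1]
      have h1 : √(k j : ℝ) ≠ 0 := (Real.sqrt_pos.2 hj).ne'
      have h2 : √(n j : ℝ) ≠ 0 := (Real.sqrt_pos.2 hj').ne'
      simp
      field_simp
      ring) (by rw [variance_bernoulliNat hb0 hb1]; ring)
  have h2 := (hkn.mul hsq).mul h
  have e : b * √b * ((√(2 * Real.pi * (b * (1 - b))))⁻¹ *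
      Real.exp (-((-(b * (y * √b))) ^ 2 / (2 * (b * (1 - b)))))) =
      b * (√(2 * Real.pi * (1 - b)))⁻¹ * Real.exp (-(b ^ 2 * y ^ 2 / (2 * (1 - b)))) := by
    have e1 : √(2 * Real.pi * (b * (1 - b))) = √b * √(2 * Real.pi * (1 - b)) := by
      rw [← Real.sqrt_mul hb0.le]; congr 1; ring
    have e2 : (-(b * (y * √b))) ^ 2 / (2 * (b * (1 - b))) = b ^ 2 * y ^ 2 / (2 * (1 - b)) := by
      have : (-(b * (y * √b))) ^ 2 = b ^ 2 * y ^ 2 * (√b) ^ 2 := by ring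
      rw [this, Real.sq_sqrt hb0.le]
      field_simp
    rw [e1, e2, mul_inv]
    have := (Real.sqrt_pos.2 hb0).ne'
    field_simp
  rw [e] at h2
  refine h2.congr' ?_
  filter_upwards [hn0] with j hj
  have : √(n j : ℝ) ≠ 0 := (Real.sqrt_pos.2 hj).ne'
  rw [pow_zero, mul_one, coeff_genFun_bernoulliNat_pow hb0 hb1, nbWeight]
  field_simp

end

/-! ### Tree weights: local limit, domination and summation -/

/-- Up to the factor `k ^ (-3/2)`, the probability that a Galton--Watson tree has `n` vertices and
`k` vertices with outdegree in `B`; here `b = μ B` and `p`, `q` are `μ` conditioned to `B`, `Bᶜ`. -/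
noncomputable def treeWeight (b : ℝ) (p q : Measure ℕ) (k n : ℕ) : ℝ :=
  nbWeight b k n * (√k * PowerSeries.coeff (n - 1) (genFun p ^ k * genFun q ^ (n - k)))

/-- The limiting variance of the number of vertices. -/
noncomputable def sizeVar (b : ℝ) (p q : Measure ℕ) : ℝ :=
  (b ^ 2 / (1 - b) + (1 - ∫ i : ℕ, (i : ℝ) ∂q) ^ 2 /
    (Var[fun i : ℕ => (i : ℝ); p] + (1 - b) / b * Var[fun i : ℕ => (i : ℝ); q]))⁻¹

/-- The limiting total mass of the tree weights. -/
noncomputable def sizeMass (b : ℝ) (p q : Measure ℕ) : ℝ :=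
  b * (√(2 * Real.pi * (1 - b)))⁻¹ *
    (√(2 * Real.pi * (Var[fun i : ℕ => (i : ℝ); p] +
      (1 - b) / b * Var[fun i : ℕ => (i : ℝ); q])))⁻¹ * √(2 * Real.pi * sizeVar b p q)

theorem treeWeight_nonneg {b : ℝ} (hb0 : 0 ≤ b) (hb1 : b ≤ 1) (p q : Measure ℕ) (k n : ℕ) :
    0 ≤ treeWeight b p q k n :=
  mul_nonneg (nbWeight_nonneg hb0 hb1 k n)
    (mul_nonneg (Real.sqrt_nonneg _) (coeff_genFun_pow_mul_pow_nonneg p q _ _ _))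

theorem treeWeight_zero_right (b : ℝ) (p q : Measure ℕ) (k : ℕ) : treeWeight b p q k 0 = 0 := by
  simp [treeWeight, nbWeight]

/-- The integer cell containing `k / b + √k y`. -/
noncomputable def sizeCell (b : ℝ) (k : ℕ) (y : ℝ) : ℤ := ⌊(k : ℝ) / b + √k * y⌋

theorem tendsto_affine_atTop {b : ℝ} (hb0 : 0 < b) (y : ℝ) :
    Tendsto (fun j : ℕ × ℝ => (j.1 : ℝ) / b + √j.1 * j.2) (atTop ×ˢ 𝓝 y) atTop := by
  have h1 : Tendsto (fun j : ℕ × ℝ => √(j.1 : ℝ)) (atTop ×ˢ 𝓝 y) atTop :=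
    (Real.tendsto_sqrt_atTop.comp tendsto_natCast_atTop_atTop).comp tendsto_fst
  have h2 : Tendsto (fun j : ℕ × ℝ => √(j.1 : ℝ) / b + j.2) (atTop ×ˢ 𝓝 y) atTop :=
    (h1.atTop_div_const hb0).atTop_add tendsto_snd
  refine (h1.atTop_mul_atTop₀ h2).congr fun j => ?_
  have := Real.mul_self_sqrt (Nat.cast_nonneg (α := ℝ) j.1)
  rw [mul_add, ← mul_div_assoc, this]

theorem eventually_sizeCell_nonneg {b : ℝ} (hb0 : 0 < b) (y : ℝ) :
    ∀ᶠ j : ℕ × ℝ in atTop ×ˢ 𝓝 y, 0 ≤ sizeCell b j.1 j.2 := by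
  filter_upwards [(tendsto_affine_atTop hb0 y).eventually_ge_atTop 0] with j hj
  exact Int.floor_nonneg.2 hj

/-- Rounding costs at most `1 / √k`, and `toNat` is harmless because the cell is eventually
nonnegative. Letting `y` vary with `k` is the source of uniformity. -/
theorem tendsto_sizeCell {b : ℝ} (hb0 : 0 < b) (y : ℝ) :
    Tendsto (fun j : ℕ × ℝ => (((sizeCell b j.1 j.2).toNat : ℝ) - (j.1 : ℝ) / b) / √j.1)
      (atTop ×ˢ 𝓝 y) (𝓝 y) := by
  have h1 : Tendsto (fun j : ℕ × ℝ => √(j.1 : ℝ)) (atTop ×ˢ 𝓝 y) atTop :=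
    (Real.tendsto_sqrt_atTop.comp tendsto_natCast_atTop_atTop).comp tendsto_fst
  have h2 : Tendsto (fun j : ℕ × ℝ => j.2) (atTop ×ˢ 𝓝 y) (𝓝 y) := tendsto_snd
  have h3 : Tendsto (fun j : ℕ × ℝ => j.2 - 1 / √(j.1 : ℝ)) (atTop ×ˢ 𝓝 y) (𝓝 y) := by
    simpa using h2.sub (h1.const_div_atTop 1)
  refine tendsto_of_tendsto_of_tendsto_of_le_of_le' h3 h2 ?_ ?_
  all_goals
    filter_upwards [h1.eventually_gt_atTop 0, eventually_sizeCell_nonneg hb0 y] with j hj hj'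
    have e : ((sizeCell b j.1 j.2).toNat : ℝ) = (sizeCell b j.1 j.2 : ℝ) := by
      exact_mod_cast Int.toNat_of_nonneg hj'
    have hl := Int.floor_le ((j.1 : ℝ) / b + √j.1 * j.2)
    have hu := Int.lt_floor_add_one ((j.1 : ℝ) / b + √j.1 * j.2)
    rw [e, sizeCell]
  · rw [le_div_iff₀ hj, sub_mul, one_div, inv_mul_cancel₀ hj.ne']
    linarith
  · rw [div_le_iff₀ hj]
    linarith

theorem tendsto_sizeCell_left {b : ℝ} (hb0 : 0 < b) (y : ℝ) :
    Tendsto (fun k : ℕ => (((sizeCell b k y).toNat : ℝ) - (k : ℝ) / b) / √k) atTop (𝓝 y) := by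
  have hseq : Tendsto (fun k : ℕ => (k, y)) atTop (atTop ×ˢ 𝓝 y) :=
    tendsto_id.prodMk tendsto_const_nhds
  have h := (tendsto_sizeCell hb0 y).comp hseq
  simpa only [Function.comp_def] using h

theorem hasSum_comp_toNat {f : ℕ → ℝ} {a : ℝ} (h0 : f 0 = 0) (hf : HasSum f a) :
    HasSum (fun z : ℤ => f z.toNat) a := by
  refine (Function.Injective.hasSum_iff (g := (Nat.cast : ℕ → ℤ)) Nat.cast_injective ?_).1 ?_
  · intro z hz
    have : z.toNat = 0 := by
      by_contra hne
      exact hz ⟨z.toNat, by omega⟩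
    rw [this, h0]
  · simpa [Function.comp_def] using hf

/-- Each integer owns an interval of length `1 / √k` in the variable `y`. Negative integers are sent
to `0` by `toNat`, so `f 0 = 0` keeps them from contributing. -/
theorem integral_sizeCell {f : ℕ → ℝ} {a : ℝ} (h0 : f 0 = 0) (hf : HasSum f a) (b : ℝ) {k : ℕ}
    (hk : 0 < k) : ∫ y : ℝ, √(k : ℝ) * f (sizeCell b k y).toNat = a := by
  have hs := hasSum_comp_toNat h0 hf
  rw [← hs.tsum_eq, ← integral_floor_affine hs.summable ((k : ℝ) / b)
    (Real.sqrt_pos.2 (by exact_mod_cast hk : (0 : ℝ) < k))]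
  simp only [sizeCell]

theorem integrable_sizeCell {f : ℕ → ℝ} {a : ℝ} (h0 : f 0 = 0) (hf : HasSum f a) (b : ℝ) {k : ℕ}
    (hk : 0 < k) : Integrable fun y : ℝ => √(k : ℝ) * f (sizeCell b k y).toNat :=
  (integrable_floor_affine (hasSum_comp_toNat h0 hf).summable ((k : ℝ) / b)
    (Real.sqrt_pos.2 (by exact_mod_cast hk : (0 : ℝ) < k))).const_mul _

theorem measurable_sizeCell (b : ℝ) (k : ℕ) : Measurable fun y : ℝ => sizeCell b k y := by
  unfold sizeCell
  fun_prop

theorem tendsto_natCast_div_sub_one :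
    Tendsto (fun k : ℕ => (k : ℝ) / (k - 1)) atTop (𝓝 1) := by
  have h1 : Tendsto (fun k : ℕ => 1 - 1 / (k : ℝ)) atTop (𝓝 (1 - 0)) :=
    (tendsto_const_nhds).sub (tendsto_natCast_atTop_atTop.const_div_atTop 1)
  rw [sub_zero] at h1
  have h2 := h1.inv₀ one_ne_zero
  rw [inv_one] at h2
  refine h2.congr' ?_
  filter_upwards [eventually_ge_atTop 2] with k hk
  have : (k : ℝ) ≠ 0 := by
    have : k ≠ 0 := by omega
    exact_mod_cast this
  rw [one_sub_div this, inv_div]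

section

variable {b : ℝ} {p q : Measure ℕ} [IsProbabilityMeasure p] [IsProbabilityMeasure q]

theorem limitVar_pos (hb0 : 0 < b) (hb1 : b < 1) (hap : IsAperiodicNat p ∨ IsAperiodicNat q)
    (hp : MemLp (fun i : ℕ => (i : ℝ)) 2 p) (hq : MemLp (fun i : ℕ => (i : ℝ)) 2 q) :
    0 < Var[fun i : ℕ => (i : ℝ); p] + (1 - b) / b * Var[fun i : ℕ => (i : ℝ); q] := by
  have h1 := variance_nonneg (fun i : ℕ => (i : ℝ)) p
  have h2 := variance_nonneg (fun i : ℕ => (i : ℝ)) q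
  have h3 : 0 < (1 - b) / b := div_pos (by linarith) hb0
  rcases hap with h | h
  · have := h.variance_pos hp
    have := mul_nonneg h3.le h2
    linarith
  · have := mul_pos h3 (h.variance_pos hq)
    linarith

theorem sizeVar_pos (hb0 : 0 < b) (hb1 : b < 1) (hap : IsAperiodicNat p ∨ IsAperiodicNat q)
    (hp : MemLp (fun i : ℕ => (i : ℝ)) 2 p) (hq : MemLp (fun i : ℕ => (i : ℝ)) 2 q) :
    0 < sizeVar b p q := by
  have hb : 0 < 1 - b := by linarith
  have := limitVar_pos hb0 hb1 hap hp hq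
  unfold sizeVar
  positivity

theorem sizeMass_pos (hb0 : 0 < b) (hb1 : b < 1) (hap : IsAperiodicNat p ∨ IsAperiodicNat q)
    (hp : MemLp (fun i : ℕ => (i : ℝ)) 2 p) (hq : MemLp (fun i : ℕ => (i : ℝ)) 2 q) :
    0 < sizeMass b p q := by
  have hb : 0 < 1 - b := by linarith
  have := limitVar_pos hb0 hb1 hap hp hq
  have := sizeVar_pos hb0 hb1 hap hp hq
  unfold sizeMass
  positivity

/-- Two Gaussian local limits are multiplied: the exponents combine into the inverse of `sizeVar`,
and the constants into `sizeMass`. -/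
theorem tendsto_sqrt_mul_treeWeight (hb0 : 0 < b) (hb1 : b < 1)
    (hap : IsAperiodicNat p ∨ IsAperiodicNat q)
    (hp : MemLp (fun i : ℕ => (i : ℝ)) 2 p) (hq : MemLp (fun i : ℕ => (i : ℝ)) 2 q)
    (hmean : b * (∫ i : ℕ, (i : ℝ) ∂p) + (1 - b) * (∫ i : ℕ, (i : ℝ) ∂q) = 1)
    {ι : Type*} {l : Filter ι} [l.IsCountablyGenerated] {k n : ι → ℕ} {y : ℝ}
    (hk : Tendsto k l atTop) (hn : Tendsto (fun j => (n j - k j / b) / √(k j)) l (𝓝 y)) :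
    Tendsto (fun j => √(k j) * treeWeight b p q (k j) (n j)) l
      (𝓝 (sizeMass b p q * gaussianPDFReal 0 (sizeVar b p q).toNNReal y)) := by
  have hb : 0 < 1 - b := by linarith
  have hv := limitVar_pos hb0 hb1 hap hp hq
  have hV := sizeVar_pos hb0 hb1 hap hp hq
  set v := Var[fun i : ℕ => (i : ℝ); p] + (1 - b) / b * Var[fun i : ℕ => (i : ℝ); q] with hvdef
  set ep := ∫ i : ℕ, (i : ℝ) ∂p
  set eq := ∫ i : ℕ, (i : ℝ) ∂q with heq
  have hkR : Tendsto (fun j => (k j : ℝ)) l atTop := tendsto_natCast_atTop_atTop.comp hk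
  have hk0 : ∀ᶠ j in l, (0 : ℝ) < k j := hkR.eventually_gt_atTop 0
  have hsq : Tendsto (fun j => √(k j : ℝ)) l atTop := Real.tendsto_sqrt_atTop.comp hkR
  have hnk := tendsto_div_of_tendsto_sub_div_sqrt hk hn
  have hle : ∀ᶠ j in l, k j ≤ n j ∧ 1 ≤ n j := by
    have h1 : (1 : ℝ) < b⁻¹ := (one_lt_inv₀ hb0).2 hb1
    filter_upwards [hnk.eventually (lt_mem_nhds h1), hk0] with j hj hj0
    rw [one_lt_div hj0] at hj
    have h2 : k j < n j := by exact_mod_cast hj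
    exact ⟨h2.le, by omega⟩
  have hm : Tendsto (fun j => ((n j - k j : ℕ) : ℝ) / k j) l (𝓝 ((1 - b) / b)) := by
    have h := hnk.sub_const 1
    have e : b⁻¹ - 1 = (1 - b) / b := by field_simp
    rw [e] at h
    refine h.congr' ?_
    filter_upwards [hle, hk0] with j hj hj0
    rw [Nat.cast_sub hj.1]
    field_simp
  have h1 := tendsto_sqrt_mul_coeff_of_or (s := fun j => n j - 1) (x := (1 - eq) * y)
    (v := v) hap hp hq (div_pos hb hb0) hk hm (by
      have h := (hn.const_mul (1 - eq)).sub (hsq.const_div_atTop 1)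
      rw [sub_zero] at h
      refine h.congr' ?_
      filter_upwards [hle, hk0] with j hj hj0
      have hs : √(k j : ℝ) ≠ 0 := (Real.sqrt_pos.2 hj0).ne'
      rw [Nat.cast_sub hj.1, Nat.cast_sub hj.2, Nat.cast_one, ← mul_div_assoc, ← sub_div]
      congr 1
      -- The mean-one condition reads `1 - eq = b (ep - eq)`. Hence the sum of outdegrees `n - 1`
      -- deviates from its mean by `(1 - eq) (n - k / b) - 1`, without any drift of order `k`.
      have h2 : (k j : ℝ) / b * (1 - eq) = k j * (ep - eq) := by
        field_simp
        linear_combination -hmean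
      linear_combination -h2) hvdef
  have h2 := (tendsto_sqrt_mul_nbWeight hb0 hb1 hk hn).mul h1
  have e : b * (√(2 * Real.pi * (1 - b)))⁻¹ * Real.exp (-(b ^ 2 * y ^ 2 / (2 * (1 - b)))) *
      ((√(2 * Real.pi * v))⁻¹ * Real.exp (-(((1 - eq) * y) ^ 2 / (2 * v)))) =
      sizeMass b p q * gaussianPDFReal 0 (sizeVar b p q).toNNReal y := by
    rw [gaussianPDFReal, Real.coe_toNNReal _ hV.le, sizeMass, ← hvdef, sub_zero]
    have h3 : √(2 * Real.pi * sizeVar b p q) ≠ 0 := by positivity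
    have h4 : Real.exp (-y ^ 2 / (2 * sizeVar b p q)) =
        Real.exp (-(b ^ 2 * y ^ 2 / (2 * (1 - b)))) *
          Real.exp (-(((1 - eq) * y) ^ 2 / (2 * v))) := by
      rw [← Real.exp_add]
      congr 1
      have h5 : -y ^ 2 / (2 * sizeVar b p q) = -y ^ 2 / 2 * (sizeVar b p q)⁻¹ := by
        field_simp
      rw [h5, sizeVar, inv_inv, ← hvdef, ← heq]
      field_simp
      ring
    rw [h4]
    field_simp
  rw [e] at h2
  refine h2.congr fun j => ?_
  rw [treeWeight]
  ring

/-- The weights dominating the tree weights. -/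
noncomputable def domWeight (b : ℝ) (k n : ℕ) : ℝ :=
  nbWeight b k n + k / (k - 1) * (b / (1 - b)) * nbWeight b (k - 1) n

theorem exists_treeWeight_le (hb0 : 0 < b) (hb1 : b < 1)
    (hap : IsAperiodicNat p ∨ IsAperiodicNat q)
    (hp : MemLp (fun i : ℕ => (i : ℝ)) 2 p) (hq : MemLp (fun i : ℕ => (i : ℝ)) 2 q) :
    ∃ C : ℝ, 0 ≤ C ∧ ∀ k n : ℕ, 2 ≤ k → treeWeight b p q k n ≤ C * domWeight b k n := by
  obtain ⟨C, hC0, hC⟩ := exists_sqrt_mul_coeff_le_of_or hap hp hq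
  refine ⟨C, hC0, fun k n hk => ?_⟩
  rcases lt_or_ge n k with hlt | hge
  · rw [treeWeight, nbWeight_of_lt b hlt, zero_mul, domWeight]
    have h1 := nbWeight_nonneg hb0.le hb1.le k n
    have h2 := nbWeight_nonneg hb0.le hb1.le (k - 1) n
    have h3 : (0 : ℝ) ≤ (k : ℝ) - 1 := by
      have : (2 : ℝ) ≤ k := by exact_mod_cast hk
      linarith
    have h4 : 0 < 1 - b := by linarith
    positivity
  · calc treeWeight b p q k n ≤ nbWeight b k n * (C * (1 + k / ((n - k : ℕ) + 1))) :=
          mul_le_mul_of_nonneg_left (hC _ _ _) (nbWeight_nonneg hb0.le hb1.le k n)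
      _ = C * (nbWeight b k n + nbWeight b k n * (k / ((n - k : ℕ) + 1))) := by ring
      _ = C * domWeight b k n := by rw [nbWeight_mul_div hb1 hk hge, domWeight]

theorem hasSum_domWeight (hb0 : 0 < b) (hb1 : b < 1) {k : ℕ} (hk : 2 ≤ k) :
    HasSum (domWeight b k) (1 + k / (k - 1) * (b / (1 - b))) := by
  have h1 := hasSum_nbWeight hb0 hb1 (show 0 < k by omega)
  have h2 := (hasSum_nbWeight hb0 hb1 (show 0 < k - 1 by omega)).mul_left
    ((k : ℝ) / (k - 1) * (b / (1 - b)))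
  rw [mul_one] at h2
  exact h1.add h2

theorem tendsto_sqrt_mul_domWeight (hb0 : 0 < b) (hb1 : b < 1)
    {ι : Type*} {l : Filter ι} [l.IsCountablyGenerated] {k n : ι → ℕ} {y : ℝ}
    (hk : Tendsto k l atTop) (hn : Tendsto (fun j => (n j - k j / b) / √(k j)) l (𝓝 y)) :
    Tendsto (fun j => √(k j) * domWeight b (k j) (n j)) l
      (𝓝 ((1 + b / (1 - b)) *
        gaussianPDFReal 0 ((1 - b) / b ^ 2).toNNReal y)) := by
  have hb : 0 < 1 - b := by linarith
  have hkR : Tendsto (fun j => (k j : ℝ)) l atTop := tendsto_natCast_atTop_atTop.comp hk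
  have hk0 : ∀ᶠ j in l, (0 : ℝ) < k j := hkR.eventually_gt_atTop 0
  have hnk := tendsto_div_of_tendsto_sub_div_sqrt hk hn
  have hle : ∀ᶠ j in l, k j ≤ n j := by
    have h1 : (1 : ℝ) < b⁻¹ := (one_lt_inv₀ hb0).2 hb1
    filter_upwards [hnk.eventually (lt_mem_nhds h1), hk0] with j hj hj0
    rw [one_lt_div hj0] at hj
    exact_mod_cast hj.le
  have h1 := tendsto_sqrt_mul_nbWeight hb0 hb1 hk hn
  have e : b * (√(2 * Real.pi * (1 - b)))⁻¹ * Real.exp (-(b ^ 2 * y ^ 2 / (2 * (1 - b)))) =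
      gaussianPDFReal 0 ((1 - b) / b ^ 2).toNNReal y := by
    rw [gaussianPDFReal, Real.coe_toNNReal _ (by positivity), sub_zero, ← mul_div_assoc,
      Real.sqrt_div (by positivity), Real.sqrt_sq hb0.le, inv_div]
    congr 1
    congr 1
    field_simp
  rw [e] at h1
  have h2 : Tendsto (fun j => (k j : ℝ) / ((n j - k j : ℕ) + 1)) l (𝓝 (b / (1 - b))) := by
    have h3 : Tendsto (fun j => ((n j - k j : ℕ) + 1 : ℝ) / k j) l (𝓝 ((1 - b) / b)) := by
      have h := (hnk.sub_const 1).add (hkR.const_div_atTop 1)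
      have e : b⁻¹ - 1 + 0 = (1 - b) / b := by field_simp; ring
      rw [e] at h
      refine h.congr' ?_
      filter_upwards [hle, hk0] with j hj hj0
      rw [Nat.cast_sub hj]
      field_simp
    have h4 := h3.inv₀ (div_pos hb hb0).ne'
    rw [inv_div] at h4
    exact h4.congr fun j => inv_div _ _
  have h3 := (h2.const_add 1).mul h1
  refine h3.congr' ?_
  filter_upwards [hle, hk.eventually_ge_atTop 2] with j hj hj2
  -- Read backwards, the absorption identity makes the majorant `nbWeight b k n` times `1 + k / (n -
  -- k + 1)`, whose limit is `1 + b / (1 - b)`.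
  rw [domWeight, ← nbWeight_mul_div hb1 hj2 hj]
  ring

theorem summable_treeWeight_mul (hb0 : 0 < b) (hb1 : b < 1)
    (hap : IsAperiodicNat p ∨ IsAperiodicNat q)
    (hp : MemLp (fun i : ℕ => (i : ℝ)) 2 p) (hq : MemLp (fun i : ℕ => (i : ℝ)) 2 q)
    {k : ℕ} (hk : 2 ≤ k) {f : ℕ → ℝ} {M : ℝ} (hM : ∀ n, |f n| ≤ M) :
    Summable fun n : ℕ => treeWeight b p q k n * f n := by
  obtain ⟨C, hC0, hC⟩ := exists_treeWeight_le hb0 hb1 hap hp hq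
  refine Summable.of_norm_bounded
    (((hasSum_domWeight hb0 hb1 hk).summable.mul_left C).mul_right M) fun n => ?_
  rw [norm_mul, Real.norm_of_nonneg (treeWeight_nonneg hb0.le hb1.le p q k n)]
  exact mul_le_mul (hC k n hk) (hM _) (norm_nonneg _)
    ((treeWeight_nonneg hb0.le hb1.le p q k n).trans (hC k n hk))

/-- Convergence of the sums of the tree weights against bounded continuous functions. -/
theorem tendsto_tsum_treeWeight (hb0 : 0 < b) (hb1 : b < 1)
    (hap : IsAperiodicNat p ∨ IsAperiodicNat q)
    (hp : MemLp (fun i : ℕ => (i : ℝ)) 2 p) (hq : MemLp (fun i : ℕ => (i : ℝ)) 2 q)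
    (hmean : b * (∫ i : ℕ, (i : ℝ) ∂p) + (1 - b) * (∫ i : ℕ, (i : ℝ) ∂q) = 1)
    {h : ℝ → ℝ} (hc : Continuous h) {M : ℝ} (hM : ∀ x, |h x| ≤ M) :
    Tendsto (fun k : ℕ => ∑' n : ℕ, treeWeight b p q k n * h ((n - k / b) / √k)) atTop
      (𝓝 (∫ y, sizeMass b p q * gaussianPDFReal 0 (sizeVar b p q).toNNReal y * h y)) := by
  have hb : 0 < 1 - b := by linarith
  obtain ⟨C, hC0, hC⟩ := exists_treeWeight_le hb0 hb1 hap hp hq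
  have hcell := tendsto_sizeCell_left hb0
  have hdom0 : ∀ k, domWeight b k 0 = 0 := by intro k; simp [domWeight, nbWeight]
  have hdomS : ∀ k : ℕ, 2 ≤ k → HasSum (fun n : ℕ => C * domWeight b k n * M)
      (C * (1 + k / (k - 1) * (b / (1 - b))) * M) := fun k hk =>
    ((hasSum_domWeight hb0 hb1 hk).mul_left C).mul_right M
  have hdomS0 : ∀ k, C * domWeight b k 0 * M = 0 := by intro k; simp [hdom0]
  have hbound : ∀ᶠ k : ℕ in atTop, ∀ y : ℝ,
      |√(k : ℝ) * (treeWeight b p q k (sizeCell b k y).toNat *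
        h ((((sizeCell b k y).toNat : ℝ) - k / b) / √k))| ≤
      √(k : ℝ) * (C * domWeight b k (sizeCell b k y).toNat * M) := by
    filter_upwards [eventually_ge_atTop 2] with k hk
    intro y
    have h0 := treeWeight_nonneg hb0.le hb1.le p q k (sizeCell b k y).toNat
    rw [abs_mul, abs_mul, abs_of_nonneg h0, abs_of_nonneg (Real.sqrt_nonneg _)]
    refine mul_le_mul_of_nonneg_left ?_ (Real.sqrt_nonneg _)
    exact mul_le_mul (hC _ _ hk) (hM _) (abs_nonneg _) (h0.trans (hC _ _ hk))
  have hF : ∀ y : ℝ, Tendsto (fun k : ℕ => √(k : ℝ) * (treeWeight b p q k (sizeCell b k y).toNat *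
      h ((((sizeCell b k y).toNat : ℝ) - k / b) / √k))) atTop
      (𝓝 (sizeMass b p q * gaussianPDFReal 0 (sizeVar b p q).toNNReal y * h y)) := by
    intro y
    have h1 := tendsto_sqrt_mul_treeWeight hb0 hb1 hap hp hq hmean tendsto_id (hcell y)
    have h2 : Tendsto (fun k : ℕ => h ((((sizeCell b k y).toNat : ℝ) - k / b) / √k)) atTop
        (𝓝 (h y)) := (hc.tendsto y).comp (hcell y)
    refine (h1.mul h2).congr fun k => ?_
    simp only [id]
    ring
  have hG : ∀ y : ℝ, Tendsto (fun k : ℕ => √(k : ℝ) *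
      (C * domWeight b k (sizeCell b k y).toNat * M)) atTop
      (𝓝 (C * ((1 + b / (1 - b)) *
        gaussianPDFReal 0 ((1 - b) / b ^ 2).toNNReal y) * M)) := by
    intro y
    have h1 := tendsto_sqrt_mul_domWeight hb0 hb1 tendsto_id (hcell y)
    refine ((h1.const_mul C).mul_const M).congr fun k => ?_
    simp only [id]
    ring
  -- No mass escapes from the majorant: its integral is known exactly for each `k ≥ 2` and tends to
  -- that of the limit.
  have hint : Tendsto (fun k : ℕ => ∫ y : ℝ, √(k : ℝ) *
      (C * domWeight b k (sizeCell b k y).toNat * M)) atTop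
      (𝓝 (∫ y, C * ((1 + b / (1 - b)) *
        gaussianPDFReal 0 ((1 - b) / b ^ 2).toNNReal y) * M)) := by
    have hne : ((1 - b) / b ^ 2).toNNReal ≠ 0 := by
      have : 0 < (1 - b) / b ^ 2 := by positivity
      simpa using this
    have e : ∫ y, C * ((1 + b / (1 - b)) * gaussianPDFReal 0 ((1 - b) / b ^ 2).toNNReal y) * M =
        C * (1 + 1 * (b / (1 - b))) * M := by
      rw [integral_mul_const, integral_const_mul, integral_const_mul,
        integral_gaussianPDFReal_eq_one 0 hne]
      ring
    rw [e]
    have h1 := (((tendsto_natCast_div_sub_one.mul_const (b / (1 - b))).const_add 1).const_mul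
      C).mul_const M
    refine h1.congr' ?_
    filter_upwards [eventually_ge_atTop 2] with k hk
    exact (integral_sizeCell (hdomS0 k) (hdomS k hk) b (by omega)).symm
  have hmeas : ∀ k : ℕ, AEStronglyMeasurable (fun y : ℝ => √(k : ℝ) *
      (treeWeight b p q k (sizeCell b k y).toNat *
        h ((((sizeCell b k y).toNat : ℝ) - k / b) / √k))) volume := by
    intro k
    have : Measurable fun z : ℤ => √(k : ℝ) * (treeWeight b p q k z.toNat *
      h (((z.toNat : ℝ) - k / b) / √k)) := Measurable.of_discrete
    exact (this.comp (measurable_sizeCell b k)).aestronglyMeasurable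
  have hGi : ∀ᶠ k : ℕ in atTop, Integrable fun y : ℝ => √(k : ℝ) *
      (C * domWeight b k (sizeCell b k y).toNat * M) := by
    filter_upwards [eventually_ge_atTop 2] with k hk
    exact integrable_sizeCell (hdomS0 k) (hdomS k hk) b (by omega)
  have hgi : Integrable fun y : ℝ => C * ((1 + b / (1 - b)) *
      gaussianPDFReal 0 ((1 - b) / b ^ 2).toNNReal y) * M :=
    (((integrable_gaussianPDFReal _ _).const_mul _).const_mul _).mul_const _
  have main := tendsto_integral_of_varying_domination hmeas hGi hgi hbound hF hG hint
  refine main.congr' ?_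
  filter_upwards [eventually_ge_atTop 2] with k hk
  exact integral_sizeCell (f := fun n : ℕ => treeWeight b p q k n * h ((n - k / b) / √k))
    (by simp [treeWeight_zero_right])
    (summable_treeWeight_mul hb0 hb1 hap hp hq hk fun n => hM _).hasSum b (by omega)

end

/-! ### Back to the conditioned tree and identification of the variance -/

theorem IsAperiodic.isAperiodicNat_cond {μ : Measure ℕ} {C : Set ℕ}
    (h : IsAperiodic (jumpLaw μ C)) : IsAperiodicNat (cond μ C) := by
  intro b d hd
  by_contra! hcon
  -- The residue moves by one because jumps are outdegrees minus one.
  refine h ⟨b - 1, d, hd, fun i hi => ?_⟩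
  rw [jumpLaw, Measure.map_apply (Measurable.of_discrete) (measurableSet_singleton i)] at hi
  obtain ⟨n, hn⟩ := nonempty_of_measure_ne_zero hi
  have hn' : (n : ℤ) - 1 = i := hn
  have e : (fun i : ℕ => (i : ℤ) - 1) ⁻¹' {i} = {n} := by
    ext m
    simp only [Set.mem_preimage, Set.mem_singleton_iff]
    omega
  rw [e] at hi
  have := hcon n hi
  have e2 : i - (b - 1) = n - b := by omega
  rwa [e2]

theorem integral_cond_eq (μ : Measure ℕ) (C : Set ℕ) (f : ℕ → ℝ) :
    ∫ i, f i ∂(cond μ C) = (∫ i in C, f i ∂μ) / μ.real C := by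
  rw [ProbabilityTheory.cond, integral_smul_measure, ENNReal.toReal_inv, smul_eq_mul, measureReal_def]
  field_simp

theorem memLp_cond {μ : Measure ℕ} {C : Set ℕ} (hC : μ C ≠ 0) {f : ℕ → ℝ} (hf : MemLp f 2 μ) :
    MemLp f 2 (cond μ C) :=
  (hf.restrict C).smul_measure (ENNReal.inv_ne_top.2 hC)

section

variable {μ : Measure ℕ} [IsProbabilityMeasure μ] {B : Set ℕ}

theorem gwLaw_numVertices_eq_treeWeight (hB : μ B ≠ 0) (hBc : μ Bᶜ ≠ 0) {k : ℕ} (hk : 0 < k)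
    (n : ℕ) :
    gwLaw μ {T | T.numVertices Set.univ = n ∧ T.numVertices B = k} =
      ENNReal.ofReal (treeWeight (μ.real B) (cond μ B) (cond μ Bᶜ) k n / (k * √k)) := by
  rcases n with _ | n
  · rw [gwLaw_numVertices_zero, treeWeight_zero_right]
    simp
  · rw [gwLaw_numVertices_eq μ hB hBc, treeWeight, nbWeight, Nat.add_sub_cancel]
    congr 1
    have h1 : (k : ℝ) ≠ 0 := by exact_mod_cast hk.ne'
    have h2 : √(k : ℝ) ≠ 0 := (Real.sqrt_pos.2 (by exact_mod_cast hk)).ne'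
    push_cast
    field_simp

/-- The factor `k √k` relating probabilities to tree weights does not depend on `n`, so it cancels
upon conditioning. If the conditioning event is null, both sides are `0`. -/
theorem integral_gwLawCond (hB : μ B ≠ 0) (hBc : μ Bᶜ ≠ 0) {k : ℕ} (hk : 0 < k)
    (hs : Summable (treeWeight (μ.real B) (cond μ B) (cond μ Bᶜ) k)) {f : ℕ → ℝ} {M : ℝ}
    (hM : ∀ n, |f n| ≤ M) :
    ∫ T, f (T.numVertices Set.univ) ∂(gwLawCond μ B k) =
      (∑' n, treeWeight (μ.real B) (cond μ B) (cond μ Bᶜ) k n * f n) /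
        ∑' n, treeWeight (μ.real B) (cond μ B) (cond μ Bᶜ) k n := by
  set W := treeWeight (μ.real B) (cond μ B) (cond μ Bᶜ) k
  have hW : ∀ n, 0 ≤ W n := treeWeight_nonneg measureReal_nonneg measureReal_le_one _ _ _
  have hk' : (0 : ℝ) < k * √k := by
    have : (0 : ℝ) < k := by exact_mod_cast hk
    positivity
  set E : Set PlaneTree := {T | T.numVertices B = k}
  let N : PlaneTree → ℕ := fun T => T.numVertices Set.univ
  have hN : Measurable N := measurable_from_top
  let ν : Measure ℕ := ((gwLaw μ).restrict E).map N
  have hν : ∀ n, ν {n} = ENNReal.ofReal (W n / (k * √k)) := by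
    intro n
    rw [← gwLaw_numVertices_eq_treeWeight hB hBc hk, Measure.map_apply hN (measurableSet_singleton n),
      Measure.restrict_apply (hN (measurableSet_singleton n))]
    rfl
  have hνreal : ∀ n, ν.real {n} = W n / (k * √k) := by
    intro n
    rw [measureReal_def, hν, ENNReal.toReal_ofReal (div_nonneg (hW n) hk'.le)]
  have hfin : IsFiniteMeasure ν := by
    constructor
    have := ν.tsum_indicator_apply_singleton Set.univ MeasurableSet.univ
    simp only [Set.indicator_univ, hν] at this
    rw [← this, ← ENNReal.ofReal_tsum_of_nonneg (fun n => div_nonneg (hW n) hk'.le)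
      (hs.div_const _)]
    exact ENNReal.ofReal_lt_top
  have hint : ∀ {g : ℕ → ℝ} {M : ℝ}, (∀ n, |g n| ≤ M) →
      ∫ n, g n ∂ν = (∑' n, W n * g n) / (k * √k) := by
    intro g M hg
    have hgi : Integrable g ν :=
      Integrable.of_bound (Measurable.of_discrete.aestronglyMeasurable) M (ae_of_all _ hg)
    rw [integral_countable hgi, ← tsum_div_const]
    refine tsum_congr fun n => ?_
    rw [hνreal, smul_eq_mul]
    ring
  have hone : (gwLaw μ E).toReal = (∑' n, W n) / (k * √k) := by
    have h1 := hint (g := fun _ => 1) (M := 1) (by simp)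
    simp only [mul_one, integral_const, smul_eq_mul] at h1
    rw [← h1, measureReal_def, Measure.map_apply hN MeasurableSet.univ]
    simp
  have h2 : ∫ T, f (N T) ∂((gwLaw μ).restrict E) = ∫ n, f n ∂ν :=
    (integral_map hN.aemeasurable (Measurable.of_discrete.aestronglyMeasurable)).symm
  change ∫ T, f (N T) ∂((gwLaw μ E)⁻¹ • (gwLaw μ).restrict E) = _
  rw [integral_smul_measure, h2, hint hM, ENNReal.toReal_inv, hone, smul_eq_mul]
  field_simp

theorem gwLawCond_real_eq (hB : μ B ≠ 0) (hBc : μ Bᶜ ≠ 0) {k : ℕ} (hk : 0 < k)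
    (hs : Summable (treeWeight (μ.real B) (cond μ B) (cond μ Bᶜ) k)) {z : ℤ} (hz : 0 ≤ z) :
    (gwLawCond μ B k).real {T | (T.numVertices Set.univ : ℤ) = z} =
      treeWeight (μ.real B) (cond μ B) (cond μ Bᶜ) k z.toNat /
        ∑' n, treeWeight (μ.real B) (cond μ B) (cond μ Bᶜ) k n := by
  have h := integral_gwLawCond hB hBc hk hs (f := ({z.toNat} : Set ℕ).indicator 1) (M := 1)
    (fun n => by by_cases hn : n = z.toNat <;> simp [hn])
  have e1 : (fun T : PlaneTree => ({z.toNat} : Set ℕ).indicator (1 : ℕ → ℝ)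
      (T.numVertices Set.univ)) =
      Set.indicator {T : PlaneTree | (T.numVertices Set.univ : ℤ) = z} 1 := by
    ext T
    have : T.numVertices Set.univ = z.toNat ↔ (T.numVertices Set.univ : ℤ) = z := by omega
    by_cases hT : T.numVertices Set.univ = z.toNat
    · rw [Set.indicator_of_mem (by simpa using hT), Set.indicator_of_mem (by simpa using this.1 hT)]
      rfl
    · rw [Set.indicator_of_notMem (by simpa using hT),
        Set.indicator_of_notMem (by simpa using fun h => hT (this.2 h))]
  rw [e1, integral_indicator_one (by trivial)] at h
  rw [h]
  congr 1
  rw [tsum_eq_single z.toNat]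
  · simp
  · intro n hn
    simp [hn]

theorem integral_natCast_cond_add (hL2 : MemLp (fun i : ℕ => (i : ℝ)) 2 μ)
    (hmean : ∫ i : ℕ, (i : ℝ) ∂μ = 1) :
    (∫ i in B, (i : ℝ) ∂μ) + ∫ i in Bᶜ, (i : ℝ) ∂μ = 1 := by
  rw [integral_add_compl (MeasurableSet.of_discrete) (hL2.integrable (by norm_num)), hmean]

theorem tsum_sub_one_mul_eq (hL2 : MemLp (fun i : ℕ => (i : ℝ)) 2 μ) :
    ∑' i : B, ((i : ℝ) - 1) * μ.real {(i : ℕ)} = (∫ i in B, (i : ℝ) ∂μ) - μ.real B := by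
  have hi : Integrable (fun i : ℕ => (i : ℝ)) μ := hL2.integrable (by norm_num)
  have h1 := setIntegral_countable (μ := μ) (fun i : ℕ => (i : ℝ) - 1) (Set.to_countable B)
    (hi.sub (integrable_const 1)).integrableOn
  rw [integral_sub hi.integrableOn (integrable_const _)] at h1
  simp only [integral_const, smul_eq_mul, mul_one, measureReal_restrict_apply_univ] at h1
  rw [h1]
  exact tsum_congr fun i => mul_comm _ _

/-- The variance coefficient of the statement, in terms of the conditioned offspring laws. -/
theorem gammaCoef_sq_div (hL2 : MemLp (fun i : ℕ => (i : ℝ)) 2 μ)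
    (hmean : ∫ i : ℕ, (i : ℝ) ∂μ = 1) (hvar : 0 < Var[fun i : ℕ => (i : ℝ); μ])
    (hB : μ B ≠ 0) (hBc : μ Bᶜ ≠ 0)
    (hap : IsAperiodicNat (cond μ B) ∨ IsAperiodicNat (cond μ Bᶜ)) :
    gammaCoef μ B ^ 2 / μ.real B ^ 3 = sizeVar (μ.real B) (cond μ B) (cond μ Bᶜ) := by
  have := cond_isProbabilityMeasure hB
  have := cond_isProbabilityMeasure hBc
  have hbB : μ.real B ≠ 0 := by simp [measureReal_def, ENNReal.toReal_eq_zero_iff, hB]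
  have hbBc : μ.real Bᶜ ≠ 0 := by simp [measureReal_def, ENNReal.toReal_eq_zero_iff, hBc]
  have hcompl : μ.real Bᶜ = 1 - μ.real B := probReal_compl_eq_one_sub (MeasurableSet.of_discrete)
  have hb0 : 0 < μ.real B := lt_of_le_of_ne measureReal_nonneg hbB.symm
  have hb1 : 0 < 1 - μ.real B := hcompl ▸ lt_of_le_of_ne measureReal_nonneg hbBc.symm
  have hv := limitVar_pos hb0 (by linarith) hap (memLp_cond hB hL2) (memLp_cond hBc hL2)
  rw [gammaCoef, sizeVar]
  rw [variance_eq_sub (memLp_cond hB hL2), variance_eq_sub (memLp_cond hBc hL2)] at hv ⊢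
  rw [tsum_sub_one_mul_eq hL2]
  simp only [integral_cond_eq, Pi.pow_apply, hcompl] at hv ⊢
  have ha := integral_natCast_cond_add (B := B) hL2 hmean
  have hsq : (∫ i in B, (i : ℝ) ^ 2 ∂μ) + ∫ i in Bᶜ, (i : ℝ) ^ 2 ∂μ =
      Var[fun i : ℕ => (i : ℝ); μ] + 1 := by
    rw [integral_add_compl (MeasurableSet.of_discrete) hL2.integrable_sq, variance_eq_sub hL2,
      hmean]
    simp
  set b := μ.real B
  set σ := Var[fun i : ℕ => (i : ℝ); μ]
  set a := ∫ i in B, (i : ℝ) ∂μ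
  set s := ∫ i in B, (i : ℝ) ^ 2 ∂μ
  have ha' : ∫ i in Bᶜ, (i : ℝ) ∂μ = 1 - a := by linarith
  have hs' : ∫ i in Bᶜ, (i : ℝ) ^ 2 ∂μ = σ + 1 - s := by linarith
  rw [ha', hs'] at hv ⊢
  set v := s / b - (a / b) ^ 2 + (1 - b) / b * ((σ + 1 - s) / (1 - b) - ((1 - a) / (1 - b)) ^ 2)
    with hvdef
  -- This identity ties the within-class variance `v` to the radicand of `gammaCoef`, which becomes
  -- `b² (1 - b) v / σ`. It is positive because `v` and `σ` are, so squaring undoes the root.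
  have hv2 : v * (b ^ 2 * (1 - b)) = b * (1 - b) * σ - (a - b) ^ 2 := by
    rw [hvdef]
    field_simp
    ring
  have hE : b * (1 - b) - 1 / σ * (a - b) ^ 2 = b ^ 2 * (1 - b) * v / σ := by
    field_simp
    linarith
  rw [hE, Real.sq_sqrt (by positivity)]
  have h3 : b ^ 2 / (1 - b) + (1 - (1 - a) / (1 - b)) ^ 2 / v = b * σ / ((1 - b) * v) := by
    have h4 : 1 - (1 - a) / (1 - b) = (a - b) / (1 - b) := by
      field_simp
      ring
    rw [h4]
    field_simp
    linarith
  rw [h3, inv_div]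
  field_simp

end

theorem mainTheorem6 (μ : Measure ℕ) [IsProbabilityMeasure μ]
    (hL2 : MemLp (fun i : ℕ => (i : ℝ)) 2 μ)
    (hmean : ∫ i : ℕ, (i : ℝ) ∂μ = 1)
    (hvar : 0 < Var[fun i : ℕ => (i : ℝ); μ])
    (B : Set ℕ) (hB : 0 < μ B) (hBc : 0 < μ Bᶜ)
    (hap : IsAperiodic (jumpLaw μ B) ∨ IsAperiodic (jumpLaw μ Bᶜ)) :
    (∀ K : Set ℝ, IsCompact K →
      TendstoUniformlyOn
        (fun (k : ℕ) (y : ℝ) =>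
          (gwLawCond μ B k).real
              {T | (T.numVertices Set.univ : ℤ) = ⌊(k : ℝ) / μ.real B + √k * y⌋} /
            (√(μ.real B ^ 3 / (2 * Real.pi * gammaCoef μ B ^ 2)) * (1 / √k) *
              Real.exp (-(μ.real B ^ 3 / gammaCoef μ B ^ 2 * (y ^ 2 / 2)))))
        (fun _ => 1) atTop K) ∧
    Tendsto (β := FiniteMeasure ℝ)
      (fun k : ℕ => ⟨rescaledSizeLaw μ B k, inferInstance⟩) atTop
      (𝓝 ⟨gaussianReal 0 (gammaCoef μ B ^ 2 / μ.real B ^ 3).toNNReal, inferInstance⟩) := by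
  have hB' := hB.ne'
  have hBc' := hBc.ne'
  have := cond_isProbabilityMeasure hB'
  have := cond_isProbabilityMeasure hBc'
  have hap' : IsAperiodicNat (cond μ B) ∨ IsAperiodicNat (cond μ Bᶜ) :=
    hap.imp IsAperiodic.isAperiodicNat_cond IsAperiodic.isAperiodicNat_cond
  have hp := memLp_cond hB' hL2
  have hq := memLp_cond hBc' hL2
  have hcompl : μ.real Bᶜ = 1 - μ.real B := probReal_compl_eq_one_sub (MeasurableSet.of_discrete)
  have hb0 : 0 < μ.real B := ENNReal.toReal_pos hB' (measure_ne_top _ _)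
  have hbc0 : 0 < μ.real Bᶜ := ENNReal.toReal_pos hBc' (measure_ne_top _ _)
  have hb1 : μ.real B < 1 := by linarith
  have hmean' : μ.real B * (∫ i : ℕ, (i : ℝ) ∂(cond μ B)) +
      (1 - μ.real B) * (∫ i : ℕ, (i : ℝ) ∂(cond μ Bᶜ)) = 1 := by
    rw [← hcompl, integral_cond_eq, integral_cond_eq, mul_div_cancel₀ _ hb0.ne',
      mul_div_cancel₀ _ hbc0.ne', integral_natCast_cond_add hL2 hmean]
  have hV := sizeVar_pos hb0 hb1 hap' hp hq
  have hZ := sizeMass_pos hb0 hb1 hap' hp hq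
  have hgamma := gammaCoef_sq_div hL2 hmean hvar hB' hBc' hap'
  set V := sizeVar (μ.real B) (cond μ B) (cond μ Bᶜ)
  set Z := sizeMass (μ.real B) (cond μ B) (cond μ Bᶜ)
  have hV0 : V.toNNReal ≠ 0 := by simpa using hV
  have hsum : ∀ k : ℕ, 2 ≤ k →
      Summable (treeWeight (μ.real B) (cond μ B) (cond μ Bᶜ) k) := by
    intro k hk
    simpa using summable_treeWeight_mul hb0 hb1 hap' hp hq hk (f := fun _ => 1) (M := 1) (by simp)
  -- The normalization is the case of the constant test function `1`.
  have hD : Tendsto (fun k => ∑' n, treeWeight (μ.real B) (cond μ B) (cond μ Bᶜ) k n) atTop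
      (𝓝 Z) := by
    have h := tendsto_tsum_treeWeight hb0 hb1 hap' hp hq hmean' (h := fun _ => 1)
      continuous_const (M := 1) (by simp)
    simp only [mul_one] at h
    rwa [integral_const_mul, integral_gaussianPDFReal_eq_one 0 hV0, mul_one] at h
  refine ⟨fun K hK => ?_, ?_⟩
  · have hpdf : ∀ y : ℝ, √(μ.real B ^ 3 / (2 * Real.pi * gammaCoef μ B ^ 2)) *
        Real.exp (-(μ.real B ^ 3 / gammaCoef μ B ^ 2 * (y ^ 2 / 2))) =
        gaussianPDFReal 0 V.toNNReal y := by
      intro y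
      have h1 : μ.real B ^ 3 / gammaCoef μ B ^ 2 = V⁻¹ := by rw [← hgamma, inv_div]
      have h2 : μ.real B ^ 3 / (2 * Real.pi * gammaCoef μ B ^ 2) = (2 * Real.pi * V)⁻¹ := by
        rw [mul_inv, ← h1]
        field_simp
      rw [h1, h2, gaussianPDFReal, Real.coe_toNNReal _ hV.le, Real.sqrt_inv, sub_zero]
      congr 2
      field_simp
    -- On a compact set it suffices to converge locally uniformly, i.e. jointly as `k → ∞` and the
    -- point tends to `y`.
    rw [← tendstoLocallyUniformlyOn_iff_tendstoUniformlyOn_of_compact hK,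
      tendstoLocallyUniformlyOn_iff_filter]
    intro y _
    rw [← tendsto_prod_filter_iff]
    refine Tendsto.mono_left ?_ (Filter.prod_mono le_rfl nhdsWithin_le_nhds)
    have h1 := tendsto_sqrt_mul_treeWeight hb0 hb1 hap' hp hq hmean'
      (tendsto_fst (f := atTop) (g := 𝓝 y)) (tendsto_sizeCell hb0 y)
    -- The mass `Z` cancels between weight and normalization, leaving the Gaussian density at `y`,
    -- which is positive and continuous and may therefore be divided out.
    have h2 := h1.div (hD.comp (tendsto_fst (f := atTop) (g := 𝓝 y))) hZ.ne'
    have hpos := gaussianPDFReal_pos 0 V.toNNReal y hV0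
    have hcont : Continuous (gaussianPDFReal 0 V.toNNReal) := by
      unfold gaussianPDFReal
      fun_prop
    have h3 := h2.div ((hcont.tendsto y).comp (tendsto_snd (f := (atTop : Filter ℕ)) (g := 𝓝 y)))
      hpos.ne'
    rw [mul_div_cancel_left₀ _ hZ.ne', div_self hpos.ne'] at h3
    refine h3.congr' ?_
    filter_upwards [eventually_sizeCell_nonneg hb0 y,
      (tendsto_fst (f := atTop) (g := 𝓝 y)).eventually (eventually_ge_atTop 2)] with j hj hk
    have hk0 : 0 < j.1 := by omega
    have hsq : √(j.1 : ℝ) ≠ 0 := (Real.sqrt_pos.2 (by exact_mod_cast hk0)).ne'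
    have h4 := gwLawCond_real_eq hB' hBc' hk0 (hsum j.1 hk) hj
    simp only [Function.HasUncurry.uncurry, id, Function.comp_apply, Pi.div_apply, ← hpdf]
    rw [sizeCell] at h4 ⊢
    rw [h4]
    field_simp
  · refine FiniteMeasure.tendsto_iff_forall_integral_tendsto.2 fun f => ?_
    change Tendsto (fun k => ∫ x, f x ∂(rescaledSizeLaw μ B k)) atTop
      (𝓝 (∫ x, f x ∂(gaussianReal 0 (gammaCoef μ B ^ 2 / μ.real B ^ 3).toNNReal)))
    have h1 := tendsto_tsum_treeWeight hb0 hb1 hap' hp hq hmean' f.continuous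
      (M := ‖f‖) (fun x => f.norm_coe_le_norm x)
    have h2 := h1.div hD hZ.ne'
    have e : (∫ y, Z * gaussianPDFReal 0 V.toNNReal y * f y) / Z =
        ∫ y, f y ∂(gaussianReal 0 (gammaCoef μ B ^ 2 / μ.real B ^ 3).toNNReal) := by
      rw [hgamma, integral_gaussianReal_eq_integral_smul hV0]
      simp only [mul_assoc, integral_const_mul, smul_eq_mul]
      rw [mul_div_cancel_left₀ _ hZ.ne']
    rw [e] at h2
    refine h2.congr' ?_
    filter_upwards [eventually_ge_atTop 2] with k hk
    have h3 := integral_gwLawCond hB' hBc' (show 0 < k by omega) (hsum k hk)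
      (f := fun n : ℕ => f ((n - k / μ.real B) / √k)) (M := ‖f‖) (fun n => f.norm_coe_le_norm _)
    simp only [Pi.div_apply]
    rw [← h3]
    rw [rescaledSizeLaw, integral_map measurable_from_top.aemeasurable
      f.continuous.aestronglyMeasurable]
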